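/- Let $G$ be a noncompact amenable locally compact Hausdorff group with left Haar measure $|\cdot|$, and let $\kappa$ be the least cardinality of a family of compact sets covering $G$. Let $\mathcal K$ be a family of compact subsets of $G$ with $|\mathcal K|=\kappa$, closed under finite unions, such that the interiors of its members cover $G$. Let $\Gamma=\{(K,n): K\in\mathcal K,\ n=1,2,3,\dots\}$, ordered by $(K,m)\preceq(J,n)$ iff $K\subseteq J$ and $m\le n$. For $\gamma=(K,n)\in\Gamma$ let $F_\gamma\subset G$ be any compact set with $|F_\gamma|>0$ that is $(K,\frac1n)$-left-invariant, i.e. $\lambda_\gamma=1_{F_\gamma}/|F_\gamma|$ satisfies $\|l_x\lambda_\gamma-\lambda_\gamma\|_1<\frac1n$ for all $x\in K$, where $l_xf(y)=f(x^{-1}y)$. (Amenability guarantees that such sets exist; conversely their existence implies amenability, so it is not a separate hypothesis.) Let $\rho_\gamma(x)=\lambda_\gamma(x^{-1})\,\Delta(x^{-1})$, where the modular function $\Delta$ is defined by $|Ut|=|U|\,\Delta(t)$. Write $\mathcal P_1(G)=\{f\in L_1(G): f\ge 0,\ \|f\|_1=1\}$. (1) There is $(t_\gamma)\in G^\Gamma$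 such that the sets $F_\gamma t_\gamma F_\gamma^{-1}$, $\gamma\in\Gamma$, are mutually disjoint. (2) For all $\gamma\in\Gamma$ and $t\in G$, $\{x : (\lambda_\gamma*(l_t\rho_\gamma))(x)\ne 0\}\subset F_\gamma tF_\gamma^{-1}$. (3) For every $(t_\gamma)$ as in (1), $\varphi_\gamma=\lambda_\gamma*(l_{t_\gamma}\rho_\gamma)$ is an orthogonal two-sided TI-net in $\mathcal P_1(G)$: $\Gamma$ is directed; each $\varphi_\gamma\in\mathcal P_1(G)$; $\|g*\varphi_\gamma-\varphi_\gamma\|_1\to0$ and $\|\varphi_\gamma*g-\varphi_\gamma\|_1\to0$ for every $g\in\mathcal P_1(G)$; and for $\gamma\ne\beta$ the support projections in $L_\infty(G)$ satisfy $S(\varphi_\gamma)S(\varphi_\beta)=0$, where $S(f)$ is the infimum of all projections $P\in L_\infty(G)$ with $\langle P,f\rangle=1$. -/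

import Mathlib

open MeasureTheory Set Filter Topology
open scoped Pointwise ENNReal NNReal

namespace DisjointFolner

section Covering

/-- The covering number `κ(G)`: the least cardinality of a family of compact sets covering `G`. -/
noncomputable def compactCoveringNumber (G : Type*) [TopologicalSpace G] : Cardinal :=
  sInf {c | ∃ 𝒦 : Set (Set G), (∀ K ∈ 𝒦, IsCompact K) ∧ ⋃₀ 𝒦 = univ ∧ Cardinal.mk 𝒦 = c}

/-- A family of compact sets of cardinality `κ(G)`, closed under finite unions, whose members have
interiors that cover `G`. -/
structure IsKappaFamily {G : Type*} [TopologicalSpace G] (𝒦 : Set (Set G)) : Prop where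
  isCompact : ∀ K ∈ 𝒦, IsCompact K
  card_eq : Cardinal.mk 𝒦 = compactCoveringNumber G
  union_mem : ∀ K ∈ 𝒦, ∀ J ∈ 𝒦, K ∪ J ∈ 𝒦
  iUnion_interior : ⋃ K ∈ 𝒦, interior K = univ

/-- The index set `Γ = {(K, n) : K ∈ 𝒦, n = 1, 2, …}`. It carries the product order:
`(K, m) ≤ (J, n)` iff `K ⊆ J` and `m ≤ n`. -/
abbrev Idx {G : Type*} (𝒦 : Set (Set G)) : Type _ := 𝒦 × ℕ+

theorem idx_le_iff {G : Type*} {𝒦 : Set (Set G)} (γ β : Idx 𝒦) :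
    γ ≤ β ↔ (γ.1 : Set G) ⊆ (β.1 : Set G) ∧ γ.2 ≤ β.2 := Iff.rfl

end Covering

section Group

variable {G : Type*} [Group G]

/-- Left translation, `(l_t f)(x) = f (t⁻¹ x)`. -/
def leftTranslate (t : G) (f : G → ℝ) : G → ℝ := fun x => f (t⁻¹ * x)

/-- Convolution, `(f * g)(x) = ∫ f(y) g(y⁻¹ x) dy`. -/
noncomputable def conv [MeasurableSpace G] (μ : Measure G) (f g : G → ℝ) : G → ℝ :=
  fun x => ∫ y, f y * g (y⁻¹ * x) ∂μ

/-- The modular function normalized by `|U t| = |U| Δ(t)`. Mathlib's modular character at `g` is the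
ratio `|U g⁻¹| / |U|`, hence the inverse. See `measure_mul_singleton_eq`. -/
noncomputable def modularFunction [TopologicalSpace G] [IsTopologicalGroup G]
    [LocallyCompactSpace G] (t : G) : ℝ≥0 := Measure.modularCharacter t⁻¹

theorem measure_mul_singleton_eq [TopologicalSpace G] [IsTopologicalGroup G]
    [LocallyCompactSpace G] [MeasurableSpace G] [BorelSpace G] (μ : Measure G) [μ.IsHaarMeasure]
    [μ.Regular] (U : Set G) (t : G) :
    μ (U * {t}) = μ U * (modularFunction t : ℝ≥0∞) := by
  have hreg : (Measure.map (· * t⁻¹) μ).Regular := Measure.Regular.map (Homeomorph.mulRight t⁻¹)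
  have h1 : Measure.map (· * t⁻¹) μ = Measure.modularCharacterFun t⁻¹ • μ := by
    rw [Measure.modularCharacterFun_eq_haarScalarFactor μ]
    exact Measure.isMulLeftInvariant_eq_smul_of_regular _ μ
  have h2 : Measure.map (· * t⁻¹) μ U = μ ((· * t⁻¹) ⁻¹' U) :=
    (Homeomorph.mulRight t⁻¹).toMeasurableEquiv.map_apply U
  rw [mul_singleton, image_mul_right, ← h2, h1, mul_comm]
  rfl

/-- The involution `f†(x) = f(x⁻¹) Δ(x⁻¹)`. -/
noncomputable def dagger [TopologicalSpace G] [IsTopologicalGroup G] [LocallyCompactSpace G]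
    (f : G → ℝ) : G → ℝ := fun x => f x⁻¹ * (modularFunction x⁻¹ : ℝ)

/-- The normalized indicator `1_F / |F|`. -/
noncomputable def normIndicator [MeasurableSpace G] (μ : Measure G) (F : Set G) : G → ℝ :=
  F.indicator fun _ => (μ.real F)⁻¹

/-- `f` represents an element of `P₁(G) = {f ∈ L₁(G) : f ≥ 0, ‖f‖₁ = 1}`. -/
structure IsP1 [MeasurableSpace G] (μ : Measure G) (f : G → ℝ) : Prop where
  integrable : Integrable f μ
  nonneg : 0 ≤ᵐ[μ] f
  integral_eq_one : ∫ x, f x ∂μ = 1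

/-- `1_S` is the support projection of the normal state `f` on `L_∞(G)`. Projections of `L_∞(G)`
are indicators of measurable sets, taken modulo null sets, and the support projection is the
infimum of all projections `1_P` with `⟨1_P, f⟩ = ⟨1, f⟩ = 1`. -/
structure IsSupportProjection [MeasurableSpace G] (μ : Measure G) (f : G → ℝ) (S : Set G) :
    Prop where
  measurableSet : MeasurableSet S
  lower : ∀ P, MeasurableSet P → ∫ x in P, f x ∂μ = 1 → S ≤ᵐ[μ] P
  greatest : ∀ Q, MeasurableSet Q →
    (∀ P, MeasurableSet P → ∫ x in P, f x ∂μ = 1 → Q ≤ᵐ[μ] P) → Q ≤ᵐ[μ] S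

/-- Orthogonality of elements of `P₁(G)`: their support projections `1_S`, `1_T` satisfy
`1_S 1_T = 0` in `L_∞(G)`. -/
def Orthogonal [MeasurableSpace G] (μ : Measure G) (f g : G → ℝ) : Prop :=
  ∃ S T, IsSupportProjection μ f S ∧ IsSupportProjection μ g T ∧ μ (S ∩ T) = 0

/-- A two-sided TI-net: a net `φ` in `P₁(G)` (indexed by a nonempty directed set) such that
`‖g * φ_γ - φ_γ‖₁ → 0` and `‖φ_γ * g - φ_γ‖₁ → 0` for all `g ∈ P₁(G)`. -/
structure IsTwoSidedTINet [MeasurableSpace G] (μ : Measure G) {Γ : Type*} [Preorder Γ]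
    (φ : Γ → G → ℝ) : Prop where
  nonempty : Nonempty Γ
  directed : ∀ a b : Γ, ∃ c, a ≤ c ∧ b ≤ c
  mem : ∀ γ, IsP1 μ (φ γ)
  left : ∀ g, IsP1 μ g →
    Tendsto (fun γ => eLpNorm (conv μ g (φ γ) - φ γ) 1 μ) atTop (𝓝 0)
  right : ∀ g, IsP1 μ g →
    Tendsto (fun γ => eLpNorm (conv μ (φ γ) g - φ γ) 1 μ) atTop (𝓝 0)

/-- A Følner net: for each `γ = (K, n)` a compact set `F γ` of positive Haar measure which is
`(K, 1/n)`-left-invariant, i.e. `‖l_x λ_γ - λ_γ‖₁ < 1/n` for all `x ∈ K`, where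
`λ_γ = 1_{F γ} / |F γ|`. -/
structure IsFolnerNet [TopologicalSpace G] [MeasurableSpace G] (μ : Measure G) {𝒦 : Set (Set G)}
    (F : Idx 𝒦 → Set G) : Prop where
  isCompact : ∀ γ, IsCompact (F γ)
  measure_pos : ∀ γ, 0 < μ (F γ)
  invariant : ∀ γ, ∀ x ∈ (γ.1 : Set G),
    eLpNorm (leftTranslate x (normIndicator μ (F γ)) - normIndicator μ (F γ)) 1 μ
      < ((γ.2 : ℕ) : ℝ≥0∞)⁻¹

/-- `λ_γ * (l_t ρ_γ)` with `λ = 1_F / |F|` and `ρ = λ†`. -/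
noncomputable def folnerConv [TopologicalSpace G] [IsTopologicalGroup G] [LocallyCompactSpace G]
    [MeasurableSpace G] (μ : Measure G) (F : Set G) (t : G) : G → ℝ :=
  conv μ (normIndicator μ F) (leftTranslate t (dagger (normIndicator μ F)))

end Group

end DisjointFolner

/-!
Write `λ = 1_F / |F|` and `φ = λ * (l_t λ†)`, where `f†(x) = f(x⁻¹) Δ(x⁻¹)`.

**Disjointness.** Since `G` is not compact, `κ(G)` is infinite and the index set has cardinality
`κ(G)`. Well-order it so that every index has fewer than `κ(G)` predecessors. The translates
`t` for which `F_γ t F_γ⁻¹` meets one of the sets already chosen form a union of fewer than `κ(G)`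
compact sets, which is not all of `G` (`exists_pairwise_disjoint_translates`).

**Invariance.** Young's inequality gives `‖l_y φ - φ‖₁ ≤ ‖l_y λ - λ‖₁`. As `f ↦ f†` is an isometry
of `L₁` that exchanges left and right translations, right translates `x ↦ Δ(w⁻¹) φ(x w⁻¹)` satisfy
the same bound (`lintegral_enorm_folnerConv_left_le`, `lintegral_enorm_folnerConv_right_le`). For
`g ∈ P₁(G)`, both `g * φ - φ` and `φ * g - φ` are averages against `g` of such differences. Since
`g` is nearly concentrated on a compact set, contained in some `K ∈ 𝒦`, Minkowski's inequality makes
these averages tend to zero (`tendsto_lintegral_enorm_integral_kernel`).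

**Fubini.** The group need be neither σ-compact nor second countable, so `μ` may fail to be σ-finite
and `(y, x) ↦ h(y⁻¹ x)` need not be measurable for the product σ-algebra. Each interchange of integrals
is therefore reduced to continuous functions of compact support. For Young's inequality the first
factor is approximated in `L₁` by continuous functions, which changes the convolution uniformly
little (`integral_conv`); this also shows that `φ` is continuous of compact support. In Minkowski's
inequality the kernel is then continuous, and `g` is carried by a σ-compact set
(`lintegral_enorm_integral_le`).

**Inversion.** Likewise `∫ f(x⁻¹) Δ(x⁻¹) dx = ∫ f(x) dx` is needed and proved only for `f` vanishing
off a compact set (`integral_inv_mul_modularCharacter`), where uniqueness of left-invariant measures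
holds without regularity. `Measure.modularCharacter x` is `Δ(x⁻¹)`.

**Orthogonality.** The support projection of the continuous function `φ ≥ 0` is the indicator of
`{φ ≠ 0} ⊆ F t F⁻¹`.
-/

universe u

namespace DisjointFolner

/-! ### The modular function and inversion -/

section Modular

variable {G : Type*} [Group G] [TopologicalSpace G] [IsTopologicalGroup G]
  [LocallyCompactSpace G]

theorem modularCharacter_mul_inv_self (x : G) :
    (Measure.modularCharacter x : ℝ) * Measure.modularCharacter x⁻¹ = 1 := by
  rw [← NNReal.coe_mul, ← map_mul, mul_inv_cancel, map_one, NNReal.coe_one]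

variable [MeasurableSpace G] [BorelSpace G]

theorem map_mul_right_eq (μ : Measure G) [μ.IsHaarMeasure] [μ.Regular] (w : G) :
    Measure.map (· * w) μ = (Measure.modularCharacter w : ℝ≥0) • μ := by
  have hreg : (Measure.map (· * w) μ).Regular := Measure.Regular.map (Homeomorph.mulRight w)
  have h := Measure.modularCharacterFun_eq_haarScalarFactor μ w
  change _ = Measure.modularCharacterFun w • μ
  rw [h]
  exact Measure.isMulLeftInvariant_eq_smul_of_regular _ μ

theorem integral_comp_mul_right (μ : Measure G) [μ.IsHaarMeasure] [μ.Regular] (f : G → ℝ) (w : G) :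
    ∫ x, f (x * w) ∂μ = (Measure.modularCharacter w : ℝ) * ∫ x, f x ∂μ := by
  have h := integral_map_equiv (μ := μ) (MeasurableEquiv.mulRight w) f
  rw [MeasurableEquiv.coe_mulRight, map_mul_right_eq, integral_smul_nnreal_measure] at h
  rw [← h, NNReal.smul_def, smul_eq_mul]

theorem lintegral_comp_mul_right (μ : Measure G) [μ.IsHaarMeasure] [μ.Regular] (f : G → ℝ≥0∞)
    (w : G) :
    ∫⁻ x, f (x * w) ∂μ = (Measure.modularCharacter w : ℝ≥0∞) * ∫⁻ x, f x ∂μ := by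
  have h := lintegral_map_equiv (μ := μ) f (MeasurableEquiv.mulRight w)
  rw [MeasurableEquiv.coe_mulRight, map_mul_right_eq, lintegral_smul_measure] at h
  rw [← h, ENNReal.smul_def, smul_eq_mul]

/-- The modular character at `w` is `∫ f(xw) dx / ∫ f(x) dx` for any continuous `f ≥ 0`, `f ≠ 0`, of
compact support, and the numerator is continuous in `w`. -/
theorem continuous_modularCharacter :
    Continuous (Measure.modularCharacter : G → ℝ≥0) := by
  let μ : Measure G := Measure.haar
  obtain ⟨⟨f, f_cont⟩, f_comp, f_nonneg, f_one⟩ :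
    ∃ f : C(G, ℝ), HasCompactSupport f ∧ 0 ≤ f ∧ f 1 ≠ 0 := exists_continuous_nonneg_pos 1
  have hne : ∫ x, f x ∂μ ≠ 0 :=
    ne_of_gt (f_cont.integral_pos_of_hasCompactSupport_nonneg_nonzero f_comp f_nonneg f_one)
  have hc : Continuous fun w => ∫ y, f (y⁻¹ * w) ∂μ.inv :=
    continuous_integral_apply_inv_mul f_cont f_comp
  have heq : ∀ w, (Measure.modularCharacter w : ℝ) =
      (∫ y, f (y⁻¹ * w) ∂μ.inv) / ∫ x, f x ∂μ := by
    intro w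
    have h1 : ∫ y, f (y⁻¹ * w) ∂μ.inv = ∫ y, f (y * w) ∂μ := by
      have := integral_map_equiv (μ := μ) (MeasurableEquiv.inv G) (fun y => f (y⁻¹ * w))
      simpa [Measure.inv] using this
    rw [h1, integral_comp_mul_right, mul_div_cancel_right₀ _ hne]
  refine NNReal.isEmbedding_coe.continuous_iff.2 ?_
  exact (hc.div_const (∫ x, f x ∂μ)).congr fun w => (heq w).symm

/-- The image under inversion of the measure with density `Δ(x⁻¹)`. It agrees with `μ` on sets
with compact closure; without σ-compactness nothing is claimed about other sets. -/
noncomputable def invModular (μ : Measure G) : Measure G :=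
  Measure.map (MeasurableEquiv.inv G)
    (μ.withDensity fun x => (Measure.modularCharacter x : ℝ≥0))

theorem lintegral_invModular (μ : Measure G) (f : G → ℝ≥0∞) (hf : Measurable f) :
    ∫⁻ x, f x ∂invModular μ = ∫⁻ x, Measure.modularCharacter x * f x⁻¹ ∂μ := by
  have hm : Measurable fun x : G => ((Measure.modularCharacter x : ℝ≥0) : ℝ≥0∞) :=
    (continuous_modularCharacter.measurable).coe_nnreal_ennreal
  rw [invModular, lintegral_map_equiv, lintegral_withDensity_eq_lintegral_mul _ hm]
  · rfl
  · exact hf.comp (MeasurableEquiv.inv G).measurable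

theorem integral_invModular (μ : Measure G) (f : G → ℝ) :
    ∫ x, f x ∂invModular μ = ∫ x, Measure.modularCharacter x * f x⁻¹ ∂μ := by
  rw [invModular, integral_map_equiv,
    integral_withDensity_eq_integral_smul continuous_modularCharacter.measurable]
  rfl

instance isFiniteMeasureOnCompacts_invModular (μ : Measure G) [IsFiniteMeasureOnCompacts μ] :
    IsFiniteMeasureOnCompacts (invModular μ) := by
  have : IsLocallyFiniteMeasure
      (μ.withDensity fun x => ((Measure.modularCharacter x : ℝ≥0) : ℝ≥0∞)) :=
    IsLocallyFiniteMeasure.withDensity_coe continuous_modularCharacter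
  constructor
  intro K hK
  rw [invModular, MeasurableEquiv.map_apply]
  exact hK.inv.measure_lt_top

/-- The change of variable `x ↦ xs` produces the factor `Δ(s⁻¹)` twice, once from the measure and
once from the density, and these cancel. -/
instance isMulLeftInvariant_invModular (μ : Measure G) [μ.IsHaarMeasure] [μ.Regular] :
    (invModular μ).IsMulLeftInvariant := by
  constructor
  intro s
  refine Measure.ext_of_lintegral _ fun f hf => ?_
  have hs : Measurable fun x : G => s * x := measurable_const_mul s
  rw [lintegral_map hf hs, lintegral_invModular _ (fun a => f (s * a)) (hf.comp hs),
    lintegral_invModular _ _ hf]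
  have h := lintegral_comp_mul_right μ
    (fun x => Measure.modularCharacter x * f (s * x⁻¹)) s
  have hne : (Measure.modularCharacter s : ℝ≥0∞) ≠ 0 := by
    exact_mod_cast (Measure.modularCharacterFun_pos s).ne'
  have h2 : ∀ x, (Measure.modularCharacter (x * s) : ℝ≥0∞) * f (s * (x * s)⁻¹) =
      Measure.modularCharacter s * (Measure.modularCharacter x * f x⁻¹) := by
    intro x
    rw [map_mul, mul_inv_rev, mul_inv_cancel_left]
    push_cast
    ring
  simp only [h2] at h
  rw [lintegral_const_mul' _ _ ENNReal.coe_ne_top] at h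
  exact ((ENNReal.mul_right_inj hne ENNReal.coe_ne_top).1 h).symm

theorem invModular_restrict_smul (μ : Measure G) [μ.IsHaarMeasure] [μ.Regular] {C : Set G}
    (hC : IsCompact (closure C)) :
    (invModular μ).restrict C =
      Measure.haarScalarFactor (invModular μ) μ • μ.restrict C := by
  ext s hs
  rw [Measure.restrict_apply hs, Measure.smul_apply, Measure.restrict_apply hs]
  exact Measure.measure_isMulInvariant_eq_smul_of_isCompact_closure _ _
    (hC.of_isClosed_subset isClosed_closure (closure_mono inter_subset_right))

theorem integral_invModular_smul [T2Space G] (μ : Measure G) [μ.IsHaarMeasure] [μ.Regular]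
    {C : Set G} (hC : IsCompact C) {f : G → ℝ} (hf : ∀ x, x ∉ C → f x = 0) :
    ∫ x, Measure.modularCharacter x * f x⁻¹ ∂μ =
      (Measure.haarScalarFactor (invModular μ) μ : ℝ) * ∫ x, f x ∂μ := by
  rw [← integral_invModular, ← setIntegral_eq_integral_of_forall_compl_eq_zero hf,
    ← setIntegral_eq_integral_of_forall_compl_eq_zero (μ := μ) hf,
    invModular_restrict_smul μ hC.closure, integral_smul_nnreal_measure]
  rfl

/-- `f ↦ f†` is involutive, so the proportionality constant between `invModular μ` and `μ` has
square one. -/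
theorem haarScalarFactor_invModular [T2Space G] (μ : Measure G) [μ.IsHaarMeasure] [μ.Regular] :
    Measure.haarScalarFactor (invModular μ) μ = 1 := by
  obtain ⟨⟨f, f_cont⟩, f_comp, f_nonneg, f_one⟩ :
    ∃ f : C(G, ℝ), HasCompactSupport f ∧ 0 ≤ f ∧ f 1 ≠ 0 := exists_continuous_nonneg_pos 1
  have hne : ∫ x, f x ∂μ ≠ 0 :=
    ne_of_gt (f_cont.integral_pos_of_hasCompactSupport_nonneg_nonzero f_comp f_nonneg f_one)
  have hf : ∀ x, x ∉ tsupport f → f x = 0 := fun x hx => image_eq_zero_of_notMem_tsupport hx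
  have h1 := integral_invModular_smul μ f_comp.isCompact hf
  have h2 := integral_invModular_smul μ f_comp.isCompact.inv
    (f := fun x => Measure.modularCharacter x * f x⁻¹) fun x hx => by
      rw [hf x⁻¹ (by simpa using hx), mul_zero]
  simp only [inv_inv, ← mul_assoc, modularCharacter_mul_inv_self, one_mul] at h2
  rw [h1, ← mul_assoc] at h2
  have h3 := mul_right_cancel₀ hne ((one_mul _).trans h2)
  have h4 : (Measure.haarScalarFactor (invModular μ) μ) *
      (Measure.haarScalarFactor (invModular μ) μ) = 1 := by exact_mod_cast h3.symm
  exact (pow_eq_one_iff_of_nonneg zero_le two_ne_zero).1 ((sq _).trans h4)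

/-- `∫ f(x⁻¹) Δ(x⁻¹) dx = ∫ f(x) dx` for every function supported in a compact set; no
measurability is needed. -/
theorem integral_inv_mul_modularCharacter [T2Space G] (μ : Measure G) [μ.IsHaarMeasure]
    [μ.Regular] {C : Set G} (hC : IsCompact C) {f : G → ℝ} (hf : ∀ x, x ∉ C → f x = 0) :
    ∫ x, Measure.modularCharacter x * f x⁻¹ ∂μ = ∫ x, f x ∂μ := by
  rw [integral_invModular_smul μ hC hf, haarScalarFactor_invModular, NNReal.coe_one, one_mul]

end Modular

/-! ### Bounded measurable functions of compact support -/

section BddCompactSupport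

variable {G : Type*} [Group G] [TopologicalSpace G] [MeasurableSpace G]

/-- `f` is a bounded measurable function vanishing outside a compact set. -/
structure IsBddCompact (f : G → ℝ) : Prop where
  measurable : Measurable f
  bounded : ∃ M, 0 ≤ M ∧ ∀ x, |f x| ≤ M
  support : ∃ C, IsCompact C ∧ ∀ x, x ∉ C → f x = 0

namespace IsBddCompact

variable {f g : G → ℝ}

omit [Group G] in
theorem sub (hf : IsBddCompact f) (hg : IsBddCompact g) : IsBddCompact (f - g) := by
  obtain ⟨M, hM, hfM⟩ := hf.bounded
  obtain ⟨N, hN, hgN⟩ := hg.bounded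
  obtain ⟨C, hC, hfC⟩ := hf.support
  obtain ⟨D, hD, hgD⟩ := hg.support
  refine ⟨hf.measurable.sub hg.measurable, ⟨M + N, by positivity, fun x => ?_⟩,
    C ∪ D, hC.union hD, fun x hx => ?_⟩
  · exact (abs_sub _ _).trans (add_le_add (hfM x) (hgN x))
  · rw [mem_union, not_or] at hx
    rw [Pi.sub_apply, hfC x hx.1, hgD x hx.2, sub_zero]

omit [Group G] in
theorem abs (hf : IsBddCompact f) : IsBddCompact fun x => |f x| := by
  obtain ⟨M, hM, hfM⟩ := hf.bounded
  obtain ⟨C, hC, hfC⟩ := hf.support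
  exact ⟨hf.measurable.abs, ⟨M, hM, fun x => (abs_abs _).trans_le (hfM x)⟩, C, hC,
    fun x hx => by rw [hfC x hx, abs_zero]⟩

omit [Group G] in
theorem integrable [T2Space G] [OpensMeasurableSpace G] (hf : IsBddCompact f) (μ : Measure G)
    [IsFiniteMeasureOnCompacts μ] : Integrable f μ := by
  obtain ⟨M, hM, hfM⟩ := hf.bounded
  obtain ⟨C, hC, hfC⟩ := hf.support
  have hsub : Function.support f ⊆ C := fun x hx => by_contra fun h => hx (hfC x h)
  rw [← integrableOn_iff_integrable_of_support_subset hsub]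
  exact Measure.integrableOn_of_bounded (M := M) hC.measure_lt_top.ne
    hf.measurable.aestronglyMeasurable (Eventually.of_forall hfM)

theorem leftTranslate [IsTopologicalGroup G] [BorelSpace G] (hf : IsBddCompact f) (t : G) :
    IsBddCompact (leftTranslate t f) := by
  obtain ⟨M, hM, hfM⟩ := hf.bounded
  obtain ⟨C, hC, hfC⟩ := hf.support
  refine ⟨hf.measurable.comp (measurable_const_mul _), ⟨M, hM, fun x => hfM _⟩,
    t • C, hC.smul t, fun x hx => hfC _ fun h => hx ?_⟩
  exact mem_smul_set_iff_inv_smul_mem.2 h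

theorem dagger [IsTopologicalGroup G] [LocallyCompactSpace G] [BorelSpace G]
    (hf : IsBddCompact f) : IsBddCompact (dagger f) := by
  obtain ⟨M, hM, hfM⟩ := hf.bounded
  obtain ⟨C, hC, hfC⟩ := hf.support
  have hcont : Continuous fun x : G => (Measure.modularCharacter x : ℝ) :=
    NNReal.continuous_coe.comp continuous_modularCharacter
  obtain ⟨B, hB⟩ := hC.inv.exists_bound_of_continuousOn hcont.continuousOn
  have heq : DisjointFolner.dagger f = fun x => f x⁻¹ * (Measure.modularCharacter x : ℝ) := by
    ext x
    simp [DisjointFolner.dagger, modularFunction]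
  have hzero : ∀ x, x ∉ C⁻¹ → f x⁻¹ = 0 := fun x hx => hfC _ fun h => hx h
  rw [heq]
  refine ⟨(hf.measurable.comp measurable_inv).mul hcont.measurable,
    ⟨M * max B 0, by positivity, fun x => ?_⟩, C⁻¹, hC.inv, fun x hx => ?_⟩
  · by_cases hx : x ∈ C⁻¹
    · rw [abs_mul]
      gcongr
      exacts [hfM _, (hB x hx).trans (le_max_left _ _)]
    · rw [hzero x hx, zero_mul, abs_zero]
      positivity
  · rw [hzero x hx, zero_mul]

end IsBddCompact

omit [Group G] in
theorem isBddCompact_normIndicator [T2Space G] [BorelSpace G] (μ : Measure G) {F : Set G}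
    (hF : IsCompact F) : IsBddCompact (normIndicator μ F) := by
  refine ⟨measurable_const.indicator hF.measurableSet, ⟨(μ.real F)⁻¹, by positivity, fun x => ?_⟩,
    F, hF, fun x hx => indicator_of_notMem hx _⟩
  by_cases hx : x ∈ F
  · rw [normIndicator, indicator_of_mem hx, abs_of_nonneg (by positivity)]
  · rw [normIndicator, indicator_of_notMem hx, abs_zero]
    positivity

end BddCompactSupport

/-! ### Continuous approximation in `L₁` -/

section Approximation

variable {X : Type*} [TopologicalSpace X] [T2Space X] [LocallyCompactSpace X] [MeasurableSpace X]
  [BorelSpace X]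

/-- With `K ⊆ t ⊆ U`, `K` compact and `U` open, a Urysohn function for the pair `(K, U)` differs
from the indicator of `t` only on `U \ K`. -/
theorem exists_continuous_eLpNorm_sub_indicator_le {μ : Measure X} [μ.Regular] (c : ℝ) {t : Set X}
    (ht : MeasurableSet t) (htμ : μ t < ∞) {δ : ℝ≥0∞} (hδ : δ ≠ 0) :
    ∃ g : X → ℝ, eLpNorm (g - t.indicator fun _ => c) 1 μ ≤ δ ∧
      Continuous g ∧ HasCompactSupport g := by
  obtain ⟨η, hη0, hη⟩ := exists_eLpNorm_indicator_le (μ := μ) ENNReal.one_ne_top c hδ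
  have hη2 : (η : ℝ≥0∞) / 2 ≠ 0 := (ENNReal.half_pos (ENNReal.coe_pos.2 hη0).ne').ne'
  obtain ⟨K, hKt, hK, -, hKμ⟩ := ht.exists_isCompact_isClosed_sdiff_lt htμ.ne hη2
  obtain ⟨U, htU, hU, -, hUμ⟩ := ht.exists_isOpen_sdiff_lt htμ.ne hη2
  obtain ⟨χ, hχ1, hχ0, hχc, hχ⟩ := exists_continuous_one_zero_of_isCompact hK
    hU.isClosed_compl (disjoint_compl_right_iff_subset.2 (hKt.trans htU))
  refine ⟨fun x => χ x * c, (eLpNorm_mono fun x => ?_).trans (hη (U \ K) ?_),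
    χ.continuous.mul continuous_const, hχc.mul_right⟩
  · by_cases hxK : x ∈ K
    · simp [hχ1 hxK, hKt hxK]
    by_cases hxU : x ∈ U
    · rw [indicator_of_mem (show x ∈ U \ K from ⟨hxU, hxK⟩)]
      by_cases hxt : x ∈ t
      · have : χ x * c - c = (χ x - 1) * c := by ring
        simp only [Pi.sub_apply, indicator_of_mem hxt, this, norm_mul]
        refine mul_le_of_le_one_left (norm_nonneg _) (abs_le.2 ⟨?_, ?_⟩) <;>
          linarith [(hχ x).1, (hχ x).2]
      · simp only [Pi.sub_apply, indicator_of_notMem hxt, sub_zero, norm_mul]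
        exact mul_le_of_le_one_left (norm_nonneg _)
          (abs_le.2 ⟨by linarith [(hχ x).1], (hχ x).2⟩)
    · have hxt : x ∉ t := fun h => hxU (htU h)
      simp [hχ0 hxU, hxt]
  · have : U \ K ⊆ (U \ t) ∪ (t \ K) := fun x hx =>
      (em (x ∈ t)).elim (fun h => Or.inr ⟨h, hx.2⟩) fun h => Or.inl ⟨hx.1, h⟩
    calc μ (U \ K) ≤ μ (U \ t) + μ (t \ K) := (measure_mono this).trans (measure_union_le _ _)
      _ ≤ η / 2 + η / 2 := add_le_add hUμ.le hKμ.le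
      _ = η := ENNReal.add_halves _

/-- Compactly supported continuous functions are dense in `L₁`. Mathlib's
`Integrable.exists_hasCompactSupport_integral_sub_le` assumes a normal space; local compactness is
enough if Urysohn's lemma is applied to a compact subset of an open set. -/
theorem exists_continuous_hasCompactSupport_integral_sub_le {μ : Measure X} [μ.Regular]
    {f : X → ℝ} (hf : Integrable f μ) {ε : ℝ} (hε : 0 < ε) :
    ∃ g : X → ℝ, HasCompactSupport g ∧ ∫ x, ‖f x - g x‖ ∂μ ≤ ε ∧ Continuous g ∧
      Integrable g μ := by
  obtain ⟨g, hg, hgc, hgs⟩ := (memLp_one_iff_integrable.2 hf).induction_dense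
    ENNReal.one_ne_top (fun g : X → ℝ => Continuous g ∧ HasCompactSupport g)
    (fun c _ ht htμ _ hδ => exists_continuous_eLpNorm_sub_indicator_le c ht htμ hδ)
    (fun _ _ h₁ h₂ => ⟨h₁.1.add h₂.1, h₁.2.add h₂.2⟩) (fun _ h => h.1.aestronglyMeasurable)
    (ENNReal.ofReal_pos.2 hε).ne'
  have hgi : Integrable g μ := hgc.integrable_of_hasCompactSupport hgs
  refine ⟨g, hgs, ?_, hgc, hgi⟩
  rw [integral_norm_eq_lintegral_enorm (f := fun x => f x - g x) (hf.sub hgi).aestronglyMeasurable]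
  rw [eLpNorm_one_eq_lintegral_enorm] at hg
  exact ENNReal.toReal_le_of_le_ofReal hε.le hg

end Approximation

/-! ### Convolution -/

section Conv

variable {G : Type*} [Group G] [TopologicalSpace G] [IsTopologicalGroup G]
  [MeasurableSpace G] [BorelSpace G]

theorem conv_eq_integral_mul_inv (μ : Measure G) [μ.IsMulLeftInvariant] (f h : G → ℝ) (x : G) :
    conv μ f h x = ∫ w, f (x * w) * h w⁻¹ ∂μ := by
  rw [conv, ← integral_mul_left_eq_self _ x]
  refine integral_congr_ae (Eventually.of_forall fun w => ?_)
  simp [mul_assoc]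

theorem integrable_mul_comp_inv_mul {μ : Measure G} {f h : G → ℝ} (hf : Integrable f μ)
    (hhm : Measurable h) {M : ℝ} (hM : ∀ x, |h x| ≤ M) (x : G) :
    Integrable (fun y => f y * h (y⁻¹ * x)) μ :=
  hf.mul_bdd (c := M) (hhm.comp (measurable_inv.mul_const x)).aestronglyMeasurable
    (Eventually.of_forall fun _ => hM _)

theorem conv_sub_left [T2Space G] {μ : Measure G} [IsFiniteMeasureOnCompacts μ] {f f' h : G → ℝ}
    (hf : IsBddCompact f) (hf' : IsBddCompact f') (hh : IsBddCompact h) :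
    conv μ (f - f') h = conv μ f h - conv μ f' h := by
  obtain ⟨M, -, hM⟩ := hh.bounded
  ext x
  rw [Pi.sub_apply, conv, conv, conv,
    ← integral_sub (integrable_mul_comp_inv_mul (hf.integrable μ) hh.measurable hM x)
      (integrable_mul_comp_inv_mul (hf'.integrable μ) hh.measurable hM x)]
  simp only [Pi.sub_apply, sub_mul]

theorem conv_sub_right [T2Space G] {μ : Measure G} [IsFiniteMeasureOnCompacts μ] {f h h' : G → ℝ}
    (hf : IsBddCompact f) (hh : IsBddCompact h) (hh' : IsBddCompact h') :
    conv μ f (h - h') = conv μ f h - conv μ f h' := by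
  obtain ⟨M, -, hM⟩ := hh.bounded
  obtain ⟨M', -, hM'⟩ := hh'.bounded
  ext x
  rw [Pi.sub_apply, conv, conv, conv,
    ← integral_sub (integrable_mul_comp_inv_mul (hf.integrable μ) hh.measurable hM x)
      (integrable_mul_comp_inv_mul (hf.integrable μ) hh'.measurable hM' x)]
  simp only [Pi.sub_apply, mul_sub]

omit [TopologicalSpace G] [IsTopologicalGroup G] [BorelSpace G] in
theorem conv_nonneg {μ : Measure G} {f h : G → ℝ} (hf : ∀ x, 0 ≤ f x) (hh : ∀ x, 0 ≤ h x)
    (x : G) : 0 ≤ conv μ f h x :=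
  integral_nonneg fun _ => mul_nonneg (hf _) (hh _)

omit [TopologicalSpace G] [IsTopologicalGroup G] [BorelSpace G] in
theorem mem_mul_of_conv_ne_zero {μ : Measure G} {f h : G → ℝ} {C D : Set G}
    (hf : ∀ x, x ∉ C → f x = 0) (hh : ∀ x, x ∉ D → h x = 0) {x : G}
    (hx : conv μ f h x ≠ 0) : x ∈ C * D := by
  by_contra hxCD
  refine hx (integral_eq_zero_of_ae (Eventually.of_forall fun y => ?_))
  by_cases hy : y ∈ C
  · have : y⁻¹ * x ∉ D := fun h => hxCD ⟨y, hy, _, h, mul_inv_cancel_left _ _⟩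
    simp [hh _ this]
  · simp [hf _ hy]

/-- For `h ≥ 0`, `f * h` averages the right translates of `f` against the measure with density
`h(w⁻¹)`. This form leaves only `f` under the integral sign, which is what makes `f * h` tractable
when `f` is continuous and `h` merely measurable. -/
theorem conv_eq_integral_withDensity (μ : Measure G) [μ.IsMulLeftInvariant] (f : G → ℝ)
    {h : G → ℝ} (hh : Measurable h) (h0 : ∀ x, 0 ≤ h x) (x : G) :
    conv μ f h x =
      ∫ w, f (x * w) ∂(μ.withDensity fun w => ((h w⁻¹).toNNReal : ℝ≥0∞)) := by
  rw [conv_eq_integral_mul_inv, integral_withDensity_eq_integral_smul]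
  · refine integral_congr_ae (Eventually.of_forall fun w => ?_)
    simp [NNReal.smul_def, h0, mul_comm]
  · exact (hh.comp measurable_inv).real_toNNReal

theorem isBddCompact_comp_inv {h : G → ℝ} (hh : IsBddCompact h) :
    IsBddCompact fun w => h w⁻¹ := by
  obtain ⟨M, hM, hhM⟩ := hh.bounded
  obtain ⟨C, hC, hhC⟩ := hh.support
  exact ⟨hh.measurable.comp measurable_inv, ⟨M, hM, fun x => hhM _⟩, C⁻¹, hC.inv,
    fun x hx => hhC _ hx⟩

variable [T2Space G]

theorem isFiniteMeasure_withDensity_inv (μ : Measure G) [IsFiniteMeasureOnCompacts μ]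
    {h : G → ℝ} (hh : IsBddCompact h) :
    IsFiniteMeasure (μ.withDensity fun w => ((h w⁻¹).toNNReal : ℝ≥0∞)) :=
  isFiniteMeasure_withDensity_ofReal ((isBddCompact_comp_inv hh).integrable μ).2

variable [LocallyCompactSpace G]

theorem continuous_conv_of_continuous (μ : Measure G) [μ.IsHaarMeasure]
    {f h : G → ℝ} (hf : Continuous f) (hfc : HasCompactSupport f) (hh : IsBddCompact h)
    (h0 : ∀ x, 0 ≤ h x) : Continuous (conv μ f h) := by
  have := isFiniteMeasure_withDensity_inv μ hh
  have hc := continuous_integral_apply_inv_mul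
    (μ := μ.withDensity fun w => ((h w⁻¹).toNNReal : ℝ≥0∞)) (hf.comp continuous_inv)
    (hfc.comp_homeomorph (Homeomorph.inv G))
  refine (hc.comp continuous_inv).congr fun x => ?_
  rw [conv_eq_integral_withDensity μ f hh.measurable h0]
  simp

/-- For `f` continuous, Fubini applies on the non-σ-finite space because
`(x, w) ↦ f(xw)` is continuous and `w` may be confined to a compact set. -/
theorem integral_conv_of_continuous (μ : Measure G) [μ.IsHaarMeasure] [μ.Regular]
    {f h : G → ℝ} (hf : Continuous f) (hfc : HasCompactSupport f) (hh : IsBddCompact h)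
    (h0 : ∀ x, 0 ≤ h x) : ∫ x, conv μ f h x ∂μ = (∫ x, f x ∂μ) * ∫ x, h x ∂μ := by
  have := isFiniteMeasure_withDensity_inv μ hh
  obtain ⟨D, hD, hhD⟩ := hh.support
  obtain ⟨χ, hχ1, -, hχc, -⟩ := exists_continuous_one_zero_of_isCompact hD.inv isClosed_empty
    (disjoint_empty _)
  have hm : Measurable fun w => (h w⁻¹).toNNReal :=
    (hh.measurable.comp measurable_inv).real_toNNReal
  -- The cutoff `χ` does not change the integral, as `h(w⁻¹)` vanishes off `D⁻¹`, and makes the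
  -- integrand compactly supported in `(x, w)`.
  have hcut : ∀ w, χ w * h w⁻¹ = h w⁻¹ := by
    intro w
    by_cases hw : w ∈ D⁻¹
    · rw [hχ1 hw, Pi.one_apply, one_mul]
    · rw [hhD _ hw, mul_zero]
  have h1 : ∀ x, conv μ f h x =
      ∫ w, χ w * f (x * w) ∂(μ.withDensity fun w => ((h w⁻¹).toNNReal : ℝ≥0∞)) := by
    intro x
    rw [conv_eq_integral_mul_inv, integral_withDensity_eq_integral_smul hm]
    refine integral_congr_ae (Eventually.of_forall fun w => ?_)
    simp only [NNReal.smul_def, Real.coe_toNNReal _ (h0 _), smul_eq_mul]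
    linear_combination -f (x * w) * hcut w
  simp only [h1]
  rw [integral_integral_swap_of_hasCompactSupport]
  · simp only [integral_const_mul, integral_comp_mul_right]
    rw [integral_withDensity_eq_integral_smul hm, ← integral_inv_mul_modularCharacter μ hD hhD,
      ← integral_const_mul]
    refine integral_congr_ae (Eventually.of_forall fun w => ?_)
    simp only [NNReal.smul_def, Real.coe_toNNReal _ (h0 _), smul_eq_mul]
    linear_combination ((∫ x, f x ∂μ) * (Measure.modularCharacter w : ℝ)) * hcut w
  · exact (χ.continuous.comp continuous_snd).mul (hf.comp (continuous_fst.mul continuous_snd))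
  · refine HasCompactSupport.intro
      (K := (tsupport f * (tsupport χ)⁻¹) ×ˢ tsupport χ)
      ((hfc.isCompact.mul hχc.isCompact.inv).prod hχc.isCompact) ?_
    rintro ⟨x, w⟩ hxw
    simp only [Function.uncurry]
    by_contra hne
    have hw : w ∈ tsupport χ := subset_tsupport _ (left_ne_zero_of_mul hne)
    have hx : x * w ∈ tsupport f := subset_tsupport _ (right_ne_zero_of_mul hne)
    exact hxw ⟨⟨_, hx, _, inv_mem_inv.2 hw, mul_inv_cancel_right _ _⟩, hw⟩

/-- Approximation in `L₁` by continuous functions with supports in a common compact set. -/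
theorem exists_compact_forall_exists_continuous_approx (μ : Measure G)
    [μ.Regular] {f : G → ℝ} (hf : IsBddCompact f) :
    ∃ L, IsCompact L ∧ ∀ ε > 0, ∃ f' : G → ℝ, Continuous f' ∧ IsBddCompact f' ∧
      HasCompactSupport f' ∧ (∀ x, x ∉ L → f' x = 0) ∧ ∫ x, |f x - f' x| ∂μ ≤ ε := by
  obtain ⟨C, hC, hfC⟩ := hf.support
  obtain ⟨χ, hχ1, -, hχc, hχ⟩ := exists_continuous_one_zero_of_isCompact hC isClosed_empty
    (disjoint_empty _)
  refine ⟨tsupport χ, hχc.isCompact, fun ε hε => ?_⟩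
  obtain ⟨f₀, hf₀c, hf₀, hf₀cont, hf₀i⟩ :=
    exists_continuous_hasCompactSupport_integral_sub_le (hf.integrable μ) hε
  have hcont : Continuous fun x => χ x * f₀ x := χ.continuous.mul hf₀cont
  have hzero : ∀ x, x ∉ tsupport χ → χ x * f₀ x = 0 := fun x hx => by
    rw [image_eq_zero_of_notMem_tsupport hx, zero_mul]
  have hcs : HasCompactSupport fun x => χ x * f₀ x := hf₀c.mul_left
  obtain ⟨M, hM⟩ := hcs.exists_bound_of_continuous hcont
  have hbdd : IsBddCompact fun x => χ x * f₀ x :=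
    ⟨hcont.measurable, ⟨M, (norm_nonneg _).trans (hM 1), hM⟩, _, hχc.isCompact, hzero⟩
  refine ⟨fun x => χ x * f₀ x, hcont, hbdd, hcs, hzero, le_trans ?_ hf₀⟩
  refine integral_mono ((hf.sub hbdd).abs.integrable μ)
    ((hf.integrable μ).sub hf₀i).norm fun x => ?_
  have hx : f x - χ x * f₀ x = χ x * (f x - f₀ x) := by
    by_cases hx : x ∈ C
    · rw [hχ1 hx, Pi.one_apply, one_mul, one_mul]
    · rw [hfC x hx]; ring
  simp only [hx, abs_mul, Real.norm_eq_abs, abs_of_nonneg (hχ x).1]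
  exact mul_le_of_le_one_left (abs_nonneg _) (hχ x).2

omit [LocallyCompactSpace G] in
theorem abs_conv_sub_conv_le {μ : Measure G} [IsFiniteMeasureOnCompacts μ] {f f' h : G → ℝ}
    (hf : IsBddCompact f) (hf' : IsBddCompact f') (hh : IsBddCompact h) {M : ℝ}
    (hM : ∀ x, |h x| ≤ M) (x : G) :
    |conv μ f h x - conv μ f' h x| ≤ M * ∫ y, |f y - f' y| ∂μ := by
  rw [← Pi.sub_apply, ← conv_sub_left hf hf' hh, conv, ← integral_const_mul]
  refine abs_integral_le_integral_abs.trans (integral_mono ?_ ?_ fun y => ?_)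
  · exact (integrable_mul_comp_inv_mul ((hf.sub hf').integrable μ) hh.measurable hM x).abs
  · exact ((hf.sub hf').abs.integrable μ).const_mul M
  · simp only [abs_mul, Pi.sub_apply, mul_comm M]
    exact mul_le_mul_of_nonneg_left (hM _) (abs_nonneg _)

/-- `f * h` is a uniform limit of convolutions with a continuous first factor. -/
theorem continuous_conv (μ : Measure G) [μ.IsHaarMeasure] [μ.Regular]
    {f h : G → ℝ} (hf : IsBddCompact f) (hh : IsBddCompact h)
    (h0 : ∀ x, 0 ≤ h x) : Continuous (conv μ f h) := by
  obtain ⟨M, hM0, hM⟩ := hh.bounded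
  obtain ⟨L, -, hL⟩ := exists_compact_forall_exists_continuous_approx μ hf
  refine continuous_of_uniform_approx_of_continuous fun u hu => ?_
  obtain ⟨ε, hε, hεu⟩ := Metric.mem_uniformity_dist.1 hu
  obtain ⟨f', hf'c, hf'b, hf's, -, hf'⟩ := hL (ε / (2 * (M + 1))) (by positivity)
  refine ⟨conv μ f' h, continuous_conv_of_continuous μ hf'c hf's hh h0, fun x => hεu ?_⟩
  rw [Real.dist_eq]
  calc _ ≤ M * ∫ y, |f y - f' y| ∂μ := abs_conv_sub_conv_le hf hf'b hh hM x
    _ ≤ (M + 1) * (ε / (2 * (M + 1))) := by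
        gcongr
        linarith
    _ = ε / 2 := by field_simp
    _ < ε := half_lt_self hε

omit [LocallyCompactSpace G] [T2Space G] [BorelSpace G] in
theorem hasCompactSupport_conv (μ : Measure G) {f h : G → ℝ} (hf : IsBddCompact f)
    (hh : IsBddCompact h) : HasCompactSupport (conv μ f h) := by
  obtain ⟨C, hC, hfC⟩ := hf.support
  obtain ⟨D, hD, hhD⟩ := hh.support
  exact HasCompactSupport.intro (hC.mul hD) fun x hx =>
    by_contra fun hne => hx (mem_mul_of_conv_ne_zero hfC hhD hne)

/-- `∫ f * h = ∫ f ∫ h`. Fubini is not applied to `f` and `h` themselves, since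
`(y, x) ↦ f(y) h(y⁻¹x)` need not be measurable for the product σ-algebra; instead `f` is
approximated in `L₁` by continuous functions, which moves `f * h` uniformly little. -/
theorem integral_conv (μ : Measure G) [μ.IsHaarMeasure] [μ.Regular]
    {f h : G → ℝ} (hf : IsBddCompact f) (hh : IsBddCompact h)
    (h0 : ∀ x, 0 ≤ h x) : ∫ x, conv μ f h x ∂μ = (∫ x, f x ∂μ) * ∫ x, h x ∂μ := by
  obtain ⟨M, hM0, hM⟩ := hh.bounded
  obtain ⟨C, hC, hfC⟩ := hf.support
  obtain ⟨D, hD, hhD⟩ := hh.support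
  obtain ⟨L, hLc, hL⟩ := exists_compact_forall_exists_continuous_approx μ hf
  set E : Set G := (C * D) ∪ (L * D) with hE
  have hEc : IsCompact E := (hC.mul hD).union (hLc.mul hD)
  set B : ℝ := M * μ.real E + |∫ x, h x ∂μ| with hB
  have hB0 : 0 ≤ B := by positivity
  have hint := (continuous_conv μ hf hh h0).integrable_of_hasCompactSupport (μ := μ)
    (hasCompactSupport_conv μ hf hh)
  have key : ∀ ε > 0, |∫ x, conv μ f h x ∂μ - (∫ x, f x ∂μ) * ∫ x, h x ∂μ| ≤ B * ε := by
    intro ε hε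
    obtain ⟨f', hf'c, hf'b, hf's, hf'L, hf'⟩ := hL ε hε
    have hint' := (continuous_conv μ hf'b hh h0).integrable_of_hasCompactSupport (μ := μ)
      (hasCompactSupport_conv μ hf'b hh)
    have e1 : |∫ x, conv μ f h x ∂μ - ∫ x, conv μ f' h x ∂μ| ≤ M * ε * μ.real E := by
      rw [← integral_sub hint hint',
        ← setIntegral_eq_integral_of_forall_compl_eq_zero (s := E) (μ := μ)]
      · have hb : ∀ x ∈ E, ‖conv μ f h x - conv μ f' h x‖ ≤ M * ε := fun x _ =>
          (abs_conv_sub_conv_le hf hf'b hh hM x).trans (mul_le_mul_of_nonneg_left hf' hM0)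
        exact norm_setIntegral_le_of_norm_le_const hEc.measure_lt_top hb
      · intro x hx
        rw [hE, mem_union, not_or] at hx
        rw [not_not.1 fun hne => hx.1 (mem_mul_of_conv_ne_zero hfC hhD hne),
          not_not.1 fun hne => hx.2 (mem_mul_of_conv_ne_zero hf'L hhD hne), sub_zero]
    have e2 : |∫ x, f' x ∂μ - ∫ x, f x ∂μ| ≤ ε := by
      rw [← integral_sub (hf'b.integrable μ) (hf.integrable μ)]
      refine abs_integral_le_integral_abs.trans (le_trans (le_of_eq ?_) hf')
      simp only [abs_sub_comm]
    rw [integral_conv_of_continuous μ hf'c hf's hh h0] at e1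
    calc _ = |(∫ x, conv μ f h x ∂μ - (∫ x, f' x ∂μ) * ∫ x, h x ∂μ) +
            (∫ x, f' x ∂μ - ∫ x, f x ∂μ) * ∫ x, h x ∂μ| := by congr 1; ring
      _ ≤ M * ε * μ.real E + ε * |∫ x, h x ∂μ| := by
          refine (abs_add_le _ _).trans (add_le_add e1 ?_)
          rw [abs_mul]
          gcongr
      _ = B * ε := by rw [hB]; ring
  refine sub_eq_zero.1 (abs_nonpos_iff.1 (le_of_forall_pos_le_add fun ε hε => ?_))
  refine (key (ε / (B + 1)) (by positivity)).trans ?_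
  rw [zero_add, mul_div_assoc', div_le_iff₀ (by positivity)]
  nlinarith

omit [LocallyCompactSpace G] [T2Space G] [TopologicalSpace G] [IsTopologicalGroup G]
  [BorelSpace G] in
theorem abs_conv_le (μ : Measure G) (f h : G → ℝ) (x : G) :
    |conv μ f h x| ≤ conv μ (fun y => |f y|) (fun y => |h y|) x := by
  simp only [conv, ← abs_mul]
  exact abs_integral_le_integral_abs

/-- Young's inequality `‖f * h‖₁ ≤ ‖f‖₁ ‖h‖₁`. -/
theorem lintegral_enorm_conv_le (μ : Measure G) [μ.IsHaarMeasure] [μ.Regular]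
    {f h : G → ℝ} (hf : IsBddCompact f) (hh : IsBddCompact h) :
    ∫⁻ x, ‖conv μ f h x‖ₑ ∂μ ≤ (∫⁻ x, ‖f x‖ₑ ∂μ) * ∫⁻ x, ‖h x‖ₑ ∂μ := by
  have h0 : ∀ x, 0 ≤ |h x| := fun x => abs_nonneg _
  have hint := (continuous_conv μ hf.abs hh.abs h0).integrable_of_hasCompactSupport (μ := μ)
    (hasCompactSupport_conv μ hf.abs hh.abs)
  calc _ ≤ ∫⁻ x, ENNReal.ofReal (conv μ (fun y => |f y|) (fun y => |h y|) x) ∂μ := by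
        refine lintegral_mono fun x => ?_
        rw [Real.enorm_eq_ofReal_abs]
        exact ENNReal.ofReal_le_ofReal (abs_conv_le μ f h x)
    _ = ENNReal.ofReal ((∫ x, |f x| ∂μ) * ∫ x, |h x| ∂μ) := by
        rw [← ofReal_integral_eq_lintegral_ofReal hint
          (Eventually.of_forall fun x => conv_nonneg (fun _ => abs_nonneg _) h0 x),
          integral_conv μ hf.abs hh.abs h0]
    _ = _ := by
        rw [ENNReal.ofReal_mul (integral_nonneg fun x => abs_nonneg _)]
        congr 1
        · exact ofReal_integral_norm_eq_lintegral_enorm (hf.integrable μ)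
        · exact ofReal_integral_norm_eq_lintegral_enorm (hh.integrable μ)

end Conv

/-! ### Tonelli's theorem for continuous kernels -/

section Tonelli

variable {X Y : Type*} [TopologicalSpace X] [TopologicalSpace Y] [T2Space X]
  [T2Space Y] [LocallyCompactSpace Y] [MeasurableSpace X] [BorelSpace X]
  [MeasurableSpace Y] [BorelSpace Y]

/-- A continuous kernel `θ(y, x)` whose slices `θ(y, ·)`, for `y` in a given compact set, are
supported in a common compact set. -/
structure IsCompactKernel (θ : Y → X → ℝ) : Prop where
  continuous : Continuous (Function.uncurry θ)
  support : ∀ C, IsCompact C → ∃ L, IsCompact L ∧ ∀ y ∈ C, ∀ x, x ∉ L → θ y x = 0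

namespace IsCompactKernel

variable {θ : Y → X → ℝ}

omit [T2Space X] [T2Space Y] [LocallyCompactSpace Y]
  [MeasurableSpace X] [BorelSpace X] [MeasurableSpace Y] [BorelSpace Y] in
theorem abs (h : IsCompactKernel θ) : IsCompactKernel fun y x => |θ y x| := by
  refine ⟨h.continuous.abs, fun C hC => ?_⟩
  obtain ⟨L, hL, hθ⟩ := h.support C hC
  exact ⟨L, hL, fun y hy x hx => by rw [hθ y hy x hx, abs_zero]⟩

/-- On a compact set of first variables the kernel can be cut off to one of compact support, for
which both iterated integrals are integrals of continuous functions of compact support. -/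
theorem lintegral_swap_of_isCompact (h : IsCompactKernel θ) (h0 : ∀ y x, 0 ≤ θ y x)
    (μ : Measure X) [IsFiniteMeasureOnCompacts μ] (ν : Measure Y) [IsFiniteMeasure ν]
    {C : Set Y} (hC : IsCompact C) :
    (Measurable fun x => ∫⁻ y in C, ENNReal.ofReal (θ y x) ∂ν) ∧
      ∫⁻ x, ∫⁻ y in C, ENNReal.ofReal (θ y x) ∂ν ∂μ =
        ∫⁻ y in C, ∫⁻ x, ENNReal.ofReal (θ y x) ∂μ ∂ν := by
  obtain ⟨χ, hχ1, -, hχc, hχ⟩ := exists_continuous_one_zero_of_isCompact hC isClosed_empty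
    (disjoint_empty _)
  obtain ⟨L, hL, hθL⟩ := h.support _ hχc.isCompact
  set θ' : X → Y → ℝ := fun x y => χ y * θ y x with hθ'
  have hcont : Continuous (Function.uncurry θ') :=
    (χ.continuous.comp continuous_snd).mul (h.continuous.comp continuous_swap)
  have h0' : ∀ x y, 0 ≤ θ' x y := fun x y => mul_nonneg (hχ y).1 (h0 y x)
  have hzero1 : ∀ x y, y ∉ tsupport χ → θ' x y = 0 := fun x y hy => by
    rw [hθ']
    simp only [image_eq_zero_of_notMem_tsupport hy, zero_mul]
  have hzero2 : ∀ x y, x ∉ L → θ' x y = 0 := fun x y hx => by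
    by_cases hy : y ∈ tsupport χ
    · simp only [hθ', hθL y hy x hx, mul_zero]
    · exact hzero1 x y hy
  have hcs : HasCompactSupport (Function.uncurry θ') := by
    refine HasCompactSupport.intro (hL.prod hχc.isCompact) ?_
    rintro ⟨x, y⟩ hxy
    by_contra hne
    exact hxy ⟨not_not.1 fun hx => hne (hzero2 x y hx), not_not.1 fun hy => hne (hzero1 x y hy)⟩
  have hx_cont : ∀ x, Continuous fun y => θ' x y := fun x =>
    hcont.comp (continuous_const.prodMk continuous_id)
  have hy_cont : ∀ y, Continuous fun x => θ' x y := fun y =>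
    hcont.comp (continuous_id.prodMk continuous_const)
  have hx_int : ∀ x, Integrable (θ' x) (ν.restrict C) := fun x =>
    (hx_cont x).integrable_of_hasCompactSupport (HasCompactSupport.intro hχc.isCompact (hzero1 x))
  have hy_int : ∀ y, Integrable (fun x => θ' x y) μ := fun y =>
    (hy_cont y).integrable_of_hasCompactSupport
      (HasCompactSupport.intro hL fun x hx => hzero2 x y hx)
  have hF : Continuous fun x => ∫ y, θ' x y ∂(ν.restrict C) := by
    rw [← continuousOn_univ]
    exact continuousOn_integral_of_compact_support hχc.isCompact hcont.continuousOn
      fun x y _ hy => hzero1 x y hy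
  have hFi : Integrable (fun x => ∫ y, θ' x y ∂(ν.restrict C)) μ :=
    hF.integrable_of_hasCompactSupport (HasCompactSupport.intro hL fun x hx => by
      simp only [hzero2 x _ hx, integral_zero])
  have hG : Continuous fun y => ∫ x, θ' x y ∂μ := by
    rw [← continuousOn_univ]
    exact continuousOn_integral_of_compact_support (f := fun y x => θ' x y) hL
      (hcont.comp continuous_swap).continuousOn fun y x _ hx => hzero2 x y hx
  have hGi : Integrable (fun y => ∫ x, θ' x y ∂μ) (ν.restrict C) :=
    hG.integrable_of_hasCompactSupport (HasCompactSupport.intro hχc.isCompact fun y hy => by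
      simp only [hzero1 _ y hy, integral_zero])
  have hinner : ∀ x, ∫⁻ y in C, ENNReal.ofReal (θ y x) ∂ν =
      ENNReal.ofReal (∫ y, θ' x y ∂(ν.restrict C)) := fun x => by
    rw [ofReal_integral_eq_lintegral_ofReal (hx_int x) (Eventually.of_forall (h0' x))]
    refine setLIntegral_congr_fun hC.measurableSet fun y hy => ?_
    simp only [hθ', hχ1 hy, Pi.one_apply, one_mul]
  have hinner2 : ∫⁻ y in C, ∫⁻ x, ENNReal.ofReal (θ y x) ∂μ ∂ν =
      ∫⁻ y in C, ENNReal.ofReal (∫ x, θ' x y ∂μ) ∂ν := by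
    refine setLIntegral_congr_fun hC.measurableSet fun y hy => ?_
    rw [ofReal_integral_eq_lintegral_ofReal (hy_int y) (Eventually.of_forall fun x => h0' x y)]
    simp only [hθ', hχ1 hy, Pi.one_apply, one_mul]
  simp only [hinner]
  refine ⟨hF.measurable.ennreal_ofReal, ?_⟩
  rw [hinner2, ← ofReal_integral_eq_lintegral_ofReal hFi
      (Eventually.of_forall fun x => integral_nonneg (h0' x)),
    ← ofReal_integral_eq_lintegral_ofReal hGi
      (Eventually.of_forall fun y => integral_nonneg fun x => h0' x y),
    integral_integral_swap_of_hasCompactSupport hcont hcs]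

/-- Tonelli's theorem for a finite measure `ν` carried by a σ-compact set and an arbitrary `μ`
finite on compact sets. -/
theorem lintegral_swap (h : IsCompactKernel θ) (h0 : ∀ y x, 0 ≤ θ y x)
    (μ : Measure X) [IsFiniteMeasureOnCompacts μ] (ν : Measure Y) [IsFiniteMeasure ν]
    {K : ℕ → Set Y} (hK : ∀ k, IsCompact (K k)) (hmono : Monotone K)
    (hν : ν (⋃ k, K k)ᶜ = 0) :
    ∫⁻ x, ∫⁻ y, ENNReal.ofReal (θ y x) ∂ν ∂μ = ∫⁻ y, ∫⁻ x, ENNReal.ofReal (θ y x) ∂μ ∂ν := by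
  have hres : ∀ f : Y → ℝ≥0∞, ∫⁻ y, f y ∂ν = ⨆ k, ∫⁻ y in K k, f y ∂ν := fun f => by
    have hr : ν.restrict (⋃ k, K k) = ν := Measure.restrict_eq_self_of_ae_mem (mem_ae_iff.2 hν)
    rw [← setLIntegral_iUnion_of_directed f hmono.directed_le, hr]
  simp only [hres]
  rw [lintegral_iSup (fun k => (h.lintegral_swap_of_isCompact h0 μ ν (hK k)).1)]
  · simp only [(h.lintegral_swap_of_isCompact h0 μ ν (hK _)).2]
  · exact fun i j hij x => lintegral_mono_set (hmono hij)

end IsCompactKernel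

/-- An integrable function is, up to `ε`, concentrated on a compact set. -/
theorem exists_isCompact_setLIntegral_compl_le {μ : Measure Y} [μ.Regular] {g : Y → ℝ}
    (hg : Integrable g μ) {ε : ℝ} (hε : 0 < ε) :
    ∃ K, IsCompact K ∧ ∫⁻ x in Kᶜ, ‖g x‖ₑ ∂μ ≤ ENNReal.ofReal ε := by
  obtain ⟨f, hfs, hf, hfc, hfi⟩ := exists_continuous_hasCompactSupport_integral_sub_le hg hε
  refine ⟨tsupport f, hfs.isCompact, ?_⟩
  calc ∫⁻ x in (tsupport f)ᶜ, ‖g x‖ₑ ∂μ = ∫⁻ x in (tsupport f)ᶜ, ‖g x - f x‖ₑ ∂μ :=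
        setLIntegral_congr_fun (isClosed_tsupport f).measurableSet.compl fun x hx => by
          simp only [image_eq_zero_of_notMem_tsupport hx, sub_zero]
    _ ≤ ∫⁻ x, ‖g x - f x‖ₑ ∂μ := setLIntegral_le_lintegral _ _
    _ = ENNReal.ofReal (∫ x, ‖g x - f x‖ ∂μ) :=
        (ofReal_integral_norm_eq_lintegral_enorm (hg.sub hfi)).symm
    _ ≤ ENNReal.ofReal ε := ENNReal.ofReal_le_ofReal hf

/-- Minkowski's inequality `‖∫ g(y) θ(y, ·) dy‖₁ ≤ ∫ |g(y)| ‖θ(y, ·)‖₁ dy`. -/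
theorem lintegral_enorm_integral_le {μ : Measure X} [IsFiniteMeasureOnCompacts μ]
    {ν : Measure Y} [ν.Regular] {g : Y → ℝ} (hgm : Measurable g) (hg : Integrable g ν)
    {θ : Y → X → ℝ} (hθ : IsCompactKernel θ) :
    ∫⁻ x, ‖∫ y, g y * θ y x ∂ν‖ₑ ∂μ ≤ ∫⁻ y, ‖g y‖ₑ * ∫⁻ x, ‖θ y x‖ₑ ∂μ ∂ν := by
  have hem : Measurable fun y => ‖g y‖ₑ := hgm.enorm
  have hlt : ∀ᵐ y ∂ν, ‖g y‖ₑ < ∞ := Eventually.of_forall fun y => enorm_lt_top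
  set ν' : Measure Y := ν.withDensity fun y => ‖g y‖ₑ with hν'
  have : IsFiniteMeasure ν' := isFiniteMeasure_withDensity hg.2.ne
  -- `ν'` is carried by a σ-compact set: take compact sets off which its mass is at most `1/(k+1)`.
  choose K₀ hK₀ hK₀ε using fun k : ℕ =>
    exists_isCompact_setLIntegral_compl_le hg (Nat.one_div_pos_of_nat (α := ℝ) (n := k))
  have hKc : ∀ k, IsCompact (Set.accumulate K₀ k) := fun k => by
    rw [Set.accumulate_def]
    exact (finite_Iic k).isCompact_biUnion fun i _ => hK₀ i
  have hzero : ν' (⋃ k, Set.accumulate K₀ k)ᶜ = 0 := by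
    rw [Set.iUnion_accumulate]
    refine le_antisymm (ge_of_tendsto' (x := atTop)
      (f := fun k : ℕ => ENNReal.ofReal (1 / ((k : ℝ) + 1))) ?_ fun k => ?_) zero_le
    · simpa using ENNReal.tendsto_ofReal (tendsto_one_div_add_atTop_nhds_zero_nat (𝕜 := ℝ))
    · calc ν' (⋃ k, K₀ k)ᶜ ≤ ν' (K₀ k)ᶜ :=
            measure_mono (compl_subset_compl.2 (subset_iUnion K₀ k))
        _ = ∫⁻ y in (K₀ k)ᶜ, ‖g y‖ₑ ∂ν := withDensity_apply _ (hK₀ k).measurableSet.compl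
        _ ≤ _ := hK₀ε k
  calc ∫⁻ x, ‖∫ y, g y * θ y x ∂ν‖ₑ ∂μ
      ≤ ∫⁻ x, ∫⁻ y, ENNReal.ofReal |θ y x| ∂ν' ∂μ := by
        refine lintegral_mono fun x => (enorm_integral_le_lintegral_enorm _).trans_eq ?_
        rw [hν', lintegral_withDensity_eq_lintegral_mul_non_measurable _ hem hlt]
        simp only [Pi.mul_apply, enorm_mul, Real.enorm_eq_ofReal_abs]
    _ = ∫⁻ y, ∫⁻ x, ENNReal.ofReal |θ y x| ∂μ ∂ν' :=
        hθ.abs.lintegral_swap (fun _ _ => abs_nonneg _) μ ν' hKc Set.monotone_accumulate hzero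
    _ = _ := by
        rw [hν', lintegral_withDensity_eq_lintegral_mul_non_measurable _ hem hlt]
        simp only [Pi.mul_apply, Real.enorm_eq_ofReal_abs]

end Tonelli

/-! ### Disjoint translates by transfinite recursion -/

section Disjointness

variable {G : Type*} [TopologicalSpace G]

theorem compactCoveringNumber_spec (G : Type*) [TopologicalSpace G] :
    ∃ 𝒦 : Set (Set G), (∀ K ∈ 𝒦, IsCompact K) ∧ ⋃₀ 𝒦 = univ ∧
      Cardinal.mk 𝒦 = compactCoveringNumber G := by
  refine csInf_mem (s := {c | ∃ 𝒦 : Set (Set G), (∀ K ∈ 𝒦, IsCompact K) ∧ ⋃₀ 𝒦 = univ ∧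
    Cardinal.mk 𝒦 = c}) ⟨_, range fun x : G => {x}, ?_, ?_, rfl⟩
  · rintro _ ⟨x, rfl⟩
    exact isCompact_singleton
  · exact eq_univ_of_forall fun x => ⟨{x}, ⟨x, rfl⟩, rfl⟩

theorem aleph0_le_compactCoveringNumber (G : Type*) [TopologicalSpace G] [NoncompactSpace G] :
    Cardinal.aleph0 ≤ compactCoveringNumber G := by
  obtain ⟨𝒦, hc, hU, hcard⟩ := compactCoveringNumber_spec G
  by_contra! hlt
  rw [← hcard, Cardinal.lt_aleph0_iff_set_finite] at hlt
  exact noncompact_univ G (hU ▸ hlt.isCompact_sUnion hc)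

theorem exists_notMem_iUnion_of_card_lt {G ι : Type u} [TopologicalSpace G] {C : ι → Set G}
    (hC : ∀ i, IsCompact (C i)) (hι : Cardinal.mk ι < compactCoveringNumber G) :
    ∃ x, ∀ i, x ∉ C i := by
  by_contra! h
  have hle : compactCoveringNumber G ≤ Cardinal.mk (range C) :=
    csInf_le' ⟨range C, by rintro _ ⟨i, rfl⟩; exact hC i,
      eq_univ_of_forall fun x => (h x).elim fun i hi => ⟨_, ⟨i, rfl⟩, hi⟩, rfl⟩
  exact (hle.trans Cardinal.mk_range_le).not_gt hι

theorem IsKappaFamily.mk_idx [NoncompactSpace G] {𝒦 : Set (Set G)} (h𝒦 : IsKappaFamily 𝒦) :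
    Cardinal.mk (Idx 𝒦) = compactCoveringNumber G := by
  have h := aleph0_le_compactCoveringNumber G
  rw [Idx, Cardinal.mk_prod, h𝒦.card_eq, Cardinal.lift_uzero, Cardinal.mk_denumerable,
    Cardinal.lift_aleph0, Cardinal.mul_aleph0_eq h]

/-- A well-order of initial type gives every index fewer than `κ(G)` predecessors, so the
translates excluded at each stage of the recursion do not cover `G`. -/
theorem exists_pairwise_disjoint_translates {G ι : Type u} [Group G] [TopologicalSpace G]
    [IsTopologicalGroup G] (hι : Cardinal.mk ι = compactCoveringNumber G) {F : ι → Set G}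
    (hF : ∀ i, IsCompact (F i)) :
    ∃ t : ι → G, Pairwise fun i j =>
      Disjoint (F i * {t i} * (F i)⁻¹) (F j * {t j} * (F j)⁻¹) := by
  obtain ⟨r, hr, hord⟩ := Cardinal.exists_ord_eq ι
  have hex : ∀ i (s : ∀ j, r j i → G), ∃ x, ∀ j : {j // r j i},
      x ∉ (F i)⁻¹ * (F j * {s j j.2} * (F j)⁻¹) * F i := fun i s => by
    refine exists_notMem_iUnion_of_card_lt (fun j => ?_) ?_
    · exact ((hF i).inv.mul (((hF _).mul isCompact_singleton).mul (hF _).inv)).mul (hF i)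
    · rw [← hι]
      exact Cardinal.card_typein_lt i hord
  choose next hnext using hex
  have hwf : WellFounded r := hr.wf
  set t : ι → G := hwf.fix next with ht
  have key : ∀ i j, r j i → Disjoint (F i * {t i} * (F i)⁻¹) (F j * {t j} * (F j)⁻¹) := by
    intro i j hji
    rw [Set.disjoint_left]
    rintro _ ⟨_, ⟨a, ha, _, rfl, rfl⟩, b, hb, rfl⟩ hmem
    have hti : t i = next i fun j _ => t j := hwf.fix_eq _ _
    refine hnext i (fun j _ => t j) ⟨j, hji⟩ ?_
    rw [← hti]
    refine ⟨_, ⟨a⁻¹, inv_mem_inv.2 ha, _, hmem, rfl⟩, b⁻¹, hb, ?_⟩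
    simp only
    group
  refine ⟨t, fun i j hij => ?_⟩
  rcases trichotomous_of r i j with h | h | h
  · exact (key j i h).symm
  · exact absurd h hij
  · exact key i j h

end Disjointness

/-! ### Averages along the index set -/

theorem IsKappaFamily.nonempty {G : Type*} [TopologicalSpace G] [Nonempty G] {𝒦 : Set (Set G)}
    (h𝒦 : IsKappaFamily 𝒦) : Nonempty 𝒦 := by
  have hx : Classical.arbitrary G ∈ ⋃ K ∈ 𝒦, interior K := h𝒦.iUnion_interior ▸ mem_univ _
  obtain ⟨K, hK, -⟩ := mem_iUnion₂.1 hx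
  exact ⟨K, hK⟩

theorem IsKappaFamily.exists_superset {G : Type*} [TopologicalSpace G] [Nonempty G]
    {𝒦 : Set (Set G)} (h𝒦 : IsKappaFamily 𝒦) {C : Set G} (hC : IsCompact C) :
    ∃ K ∈ 𝒦, C ⊆ K := by
  have := h𝒦.nonempty
  obtain ⟨K, hK⟩ := hC.elim_directed_cover (fun K : 𝒦 => interior (K : Set G))
    (fun _ => isOpen_interior)
    (by rw [iUnion_subtype, h𝒦.iUnion_interior]; exact subset_univ _)
    fun K J => ⟨⟨K ∪ J, h𝒦.union_mem _ K.2 _ J.2⟩, interior_mono subset_union_left,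
      interior_mono subset_union_right⟩
  exact ⟨K, K.2, hK.trans interior_subset⟩

theorem IsKappaFamily.directed_idx {G : Type*} [TopologicalSpace G]
    {𝒦 : Set (Set G)} (h𝒦 : IsKappaFamily 𝒦) (a b : Idx 𝒦) : ∃ c, a ≤ c ∧ b ≤ c :=
  ⟨(⟨a.1 ∪ b.1, h𝒦.union_mem _ a.1.2 _ b.1.2⟩, max a.2 b.2),
    (idx_le_iff _ _).2 ⟨subset_union_left, le_max_left _ _⟩,
    (idx_le_iff _ _).2 ⟨subset_union_right, le_max_right _ _⟩⟩

/-- Averages `∫ g(y) θ_γ(y, ·) dy` tend to zero in `L₁` as soon as `‖θ_γ(y, ·)‖₁` is bounded by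
`2`, and by `1/n` for `y ∈ K` when `γ = (K, n)`. -/
theorem tendsto_lintegral_enorm_integral_kernel {G : Type*} [TopologicalSpace G]
    [Nonempty G] [T2Space G] [LocallyCompactSpace G] [MeasurableSpace G] [BorelSpace G]
    {μ : Measure G} [μ.Regular] {𝒦 : Set (Set G)} (h𝒦 : IsKappaFamily 𝒦)
    {θ : Idx 𝒦 → G → G → ℝ} (hθ : ∀ γ, IsCompactKernel (θ γ))
    (hbdd : ∀ γ y, ∫⁻ x, ‖θ γ y x‖ₑ ∂μ ≤ 2)
    (hinv : ∀ γ, ∀ y ∈ (γ.1 : Set G), ∫⁻ x, ‖θ γ y x‖ₑ ∂μ ≤ ((γ.2 : ℕ) : ℝ≥0∞)⁻¹)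
    {g : G → ℝ} (hg : Integrable g μ) :
    Tendsto (fun γ => ∫⁻ x, ‖∫ y, g y * θ γ y x ∂μ‖ₑ ∂μ) atTop (𝓝 0) := by
  -- The integrals depend only on the class of `g`, so `g` may be taken Borel measurable.
  set g' := hg.aestronglyMeasurable.mk g with hg'
  have hae : g =ᵐ[μ] g' := hg.aestronglyMeasurable.ae_eq_mk
  have hgm : Measurable g' := hg.aestronglyMeasurable.stronglyMeasurable_mk.measurable
  have hgi : Integrable g' μ := hg.congr hae
  have hrw : ∀ γ x, ∫ y, g y * θ γ y x ∂μ = ∫ y, g' y * θ γ y x ∂μ := fun γ x =>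
    integral_congr_ae (hae.mono fun y hy => by simp only [hy])
  simp only [hrw]
  have hA : ∫⁻ y, ‖g' y‖ₑ ∂μ ≠ ∞ := hgi.2.ne
  rw [ENNReal.tendsto_nhds_zero]
  intro ε hε
  obtain ⟨δ, hδ0, hδ⟩ := ENNReal.lt_iff_exists_nnreal_btwn.1 hε
  have hδ0' : 0 < δ := ENNReal.coe_pos.1 hδ0
  obtain ⟨C, hC, hCg⟩ := exists_isCompact_setLIntegral_compl_le hgi
    (ε := (δ : ℝ) / 4) (by positivity)
  obtain ⟨K, hK, hCK⟩ := h𝒦.exists_superset hC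
  have hlim : Tendsto (fun n : ℕ => (∫⁻ y, ‖g' y‖ₑ ∂μ) * (n : ℝ≥0∞)⁻¹) atTop (𝓝 0) := by
    simpa using ENNReal.Tendsto.const_mul ENNReal.tendsto_inv_nat_nhds_zero (Or.inr hA)
  obtain ⟨n, hn, hn1⟩ := ((ENNReal.tendsto_nhds_zero.1 hlim ((δ : ℝ≥0∞) / 2)
    (ENNReal.half_pos hδ0.ne')).and (eventually_ge_atTop 1)).exists
  filter_upwards [eventually_ge_atTop ((⟨K, hK⟩, Nat.toPNat n hn1) : Idx 𝒦)] with γ hγ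
  rw [idx_le_iff] at hγ
  have hnγ : ((γ.2 : ℕ) : ℝ≥0∞)⁻¹ ≤ (n : ℝ≥0∞)⁻¹ := by
    have : n ≤ (γ.2 : ℕ) := hγ.2
    gcongr
  have hKm : MeasurableSet C := hC.measurableSet
  calc ∫⁻ x, ‖∫ y, g' y * θ γ y x ∂μ‖ₑ ∂μ
      ≤ ∫⁻ y, ‖g' y‖ₑ * ∫⁻ x, ‖θ γ y x‖ₑ ∂μ ∂μ := lintegral_enorm_integral_le hgm hgi (hθ γ)
    _ = (∫⁻ y in C, ‖g' y‖ₑ * ∫⁻ x, ‖θ γ y x‖ₑ ∂μ ∂μ) +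
          ∫⁻ y in Cᶜ, ‖g' y‖ₑ * ∫⁻ x, ‖θ γ y x‖ₑ ∂μ ∂μ := (lintegral_add_compl _ hKm).symm
    _ ≤ (∫⁻ y, ‖g' y‖ₑ ∂μ) * (n : ℝ≥0∞)⁻¹ + (∫⁻ y in Cᶜ, ‖g' y‖ₑ ∂μ) * 2 := by
        rw [← lintegral_mul_const _ hgm.enorm, ← lintegral_mul_const _ hgm.enorm]
        refine add_le_add ((setLIntegral_mono' hKm fun y hy => ?_).trans
          (setLIntegral_le_lintegral C _)) (lintegral_mono fun y => ?_)
        · exact mul_le_mul_right ((hinv γ y (hγ.1 (hCK hy))).trans hnγ) _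
        · exact mul_le_mul_right (hbdd γ y) _
    _ ≤ (δ : ℝ≥0∞) / 2 + ENNReal.ofReal ((δ : ℝ) / 4) * 2 := by
        gcongr
    _ = (δ : ℝ≥0∞) / 2 + (δ : ℝ≥0∞) / 2 := by
        congr 1
        rw [show (2 : ℝ≥0∞) = ENNReal.ofReal 2 by simp, ← ENNReal.ofReal_mul (by positivity),
          ← ENNReal.ofReal_coe_nnreal, ← ENNReal.ofReal_div_of_pos two_pos]
        congr 1
        ring
    _ ≤ ε := by
        rw [ENNReal.add_halves]
        exact hδ.le

/-! ### Translations and the involution in `L₁` -/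

section Involution

variable {G : Type*} [Group G] [TopologicalSpace G] [IsTopologicalGroup G]
  [LocallyCompactSpace G]

theorem dagger_apply (f : G → ℝ) (x : G) :
    dagger f x = Measure.modularCharacter x * f x⁻¹ := by
  simp [dagger, modularFunction, mul_comm]

theorem dagger_nonneg {f : G → ℝ} (hf : ∀ x, 0 ≤ f x) (x : G) : 0 ≤ dagger f x :=
  mul_nonneg (hf _) (NNReal.coe_nonneg _)

theorem dagger_sub (f g : G → ℝ) : dagger (f - g) = dagger f - dagger g := by
  ext x
  simp [dagger, sub_mul]

variable [MeasurableSpace G] [BorelSpace G]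

theorem integral_dagger [T2Space G] (μ : Measure G) [μ.IsHaarMeasure] [μ.Regular] {f : G → ℝ}
    (hf : IsBddCompact f) : ∫ x, dagger f x ∂μ = ∫ x, f x ∂μ := by
  obtain ⟨C, hC, hfC⟩ := hf.support
  simp only [dagger_apply]
  exact integral_inv_mul_modularCharacter μ hC hfC

theorem lintegral_enorm_dagger [T2Space G] (μ : Measure G) [μ.IsHaarMeasure] [μ.Regular]
    {f : G → ℝ} (hf : IsBddCompact f) : ∫⁻ x, ‖dagger f x‖ₑ ∂μ = ∫⁻ x, ‖f x‖ₑ ∂μ := by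
  have h : ∀ x, ‖dagger f x‖ = dagger (fun y => |f y|) x := fun x => by
    rw [dagger_apply, dagger_apply, norm_mul, Real.norm_eq_abs, Real.norm_eq_abs,
      abs_of_nonneg (NNReal.coe_nonneg _)]
  rw [← ofReal_integral_norm_eq_lintegral_enorm (hf.dagger.integrable μ),
    ← ofReal_integral_norm_eq_lintegral_enorm (hf.integrable μ)]
  simp only [h, integral_dagger μ hf.abs, Real.norm_eq_abs]

omit [LocallyCompactSpace G] in
theorem lintegral_enorm_leftTranslate (μ : Measure G) [μ.IsMulLeftInvariant] (t : G)
    (f : G → ℝ) : ∫⁻ x, ‖leftTranslate t f x‖ₑ ∂μ = ∫⁻ x, ‖f x‖ₑ ∂μ :=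
  lintegral_mul_left_eq_self (fun x => ‖f x‖ₑ) t⁻¹

omit [TopologicalSpace G] [IsTopologicalGroup G] [LocallyCompactSpace G] [MeasurableSpace G]
  [BorelSpace G] in
theorem leftTranslate_sub (t : G) (f g : G → ℝ) :
    leftTranslate t (f - g) = leftTranslate t f - leftTranslate t g := rfl

omit [LocallyCompactSpace G] in
theorem conv_leftTranslate (μ : Measure G) [μ.IsMulLeftInvariant] (f h : G → ℝ) (y x : G) :
    conv μ (leftTranslate y f) h x = conv μ f h (y⁻¹ * x) := by
  simp only [conv_eq_integral_mul_inv, leftTranslate, mul_assoc]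

omit [BorelSpace G] in
/-- A right translate of `f†` is `†` of a left translate of `f`; thus left invariance of `f`
becomes right invariance of `f†`. -/
theorem conv_leftTranslate_dagger_leftTranslate (μ : Measure G) (f k : G → ℝ) (t w x : G) :
    conv μ k (leftTranslate t (dagger (leftTranslate w⁻¹ f))) x =
      Measure.modularCharacter w * conv μ k (leftTranslate t (dagger f)) (x * w⁻¹) := by
  rw [conv, conv, ← integral_const_mul]
  refine integral_congr_ae (Eventually.of_forall fun y => ?_)
  have hw := modularCharacter_mul_inv_self w
  simp only [leftTranslate, dagger_apply, ← mul_assoc, map_mul, mul_inv_rev, inv_inv,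
    NNReal.coe_mul]
  linear_combination -(k y * (Measure.modularCharacter t⁻¹ : ℝ) *
    (Measure.modularCharacter y⁻¹ : ℝ) * (Measure.modularCharacter x : ℝ) *
    f (w * x⁻¹ * y * t)) * hw

variable [T2Space G]

/-- `‖l_y(f * h) - f * h‖₁ ≤ ‖l_y f - f‖₁ ‖h‖₁`. -/
theorem lintegral_enorm_conv_left_sub_le (μ : Measure G) [μ.IsHaarMeasure] [μ.Regular]
    {f h : G → ℝ} (hf : IsBddCompact f) (hh : IsBddCompact h) (y : G) :
    ∫⁻ x, ‖conv μ f h (y⁻¹ * x) - conv μ f h x‖ₑ ∂μ ≤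
      (∫⁻ x, ‖(leftTranslate y f - f) x‖ₑ ∂μ) * ∫⁻ x, ‖h x‖ₑ ∂μ := by
  refine le_trans (le_of_eq ?_) (lintegral_enorm_conv_le μ ((hf.leftTranslate y).sub hf) hh)
  simp only [conv_sub_left (hf.leftTranslate y) hf hh, Pi.sub_apply, conv_leftTranslate]

omit [LocallyCompactSpace G] [T2Space G] in
theorem lintegral_enorm_leftTranslate_inv_sub (μ : Measure G) [μ.IsMulLeftInvariant]
    (f : G → ℝ) (w : G) :
    ∫⁻ x, ‖(leftTranslate w⁻¹ f - f) x‖ₑ ∂μ = ∫⁻ x, ‖(leftTranslate w f - f) x‖ₑ ∂μ := by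
  rw [← lintegral_enorm_leftTranslate μ w]
  refine lintegral_congr fun x => ?_
  simp only [leftTranslate, Pi.sub_apply, inv_inv, mul_inv_cancel_left]
  exact enorm_sub_rev _ _

/-- For `h = l_t f†` and `(r_w u)(x) = Δ(w⁻¹) u(x w⁻¹)`,
`‖r_w(k * h) - k * h‖₁ ≤ ‖k‖₁ ‖l_w f - f‖₁`. -/
theorem lintegral_enorm_conv_right_sub_le (μ : Measure G) [μ.IsHaarMeasure] [μ.Regular]
    {f k : G → ℝ} (hk : IsBddCompact k) (hf : IsBddCompact f) (t w : G) :
    ∫⁻ x, ‖Measure.modularCharacter w * conv μ k (leftTranslate t (dagger f)) (x * w⁻¹) -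
        conv μ k (leftTranslate t (dagger f)) x‖ₑ ∂μ ≤
      (∫⁻ x, ‖k x‖ₑ ∂μ) * ∫⁻ x, ‖(leftTranslate w f - f) x‖ₑ ∂μ := by
  have hfw := hf.leftTranslate w⁻¹
  have h1 := lintegral_enorm_conv_le μ hk
    ((hfw.dagger.leftTranslate t).sub (hf.dagger.leftTranslate t))
  simp only [conv_sub_right hk (hfw.dagger.leftTranslate t) (hf.dagger.leftTranslate t),
    Pi.sub_apply (conv _ _ _), conv_leftTranslate_dagger_leftTranslate] at h1
  refine h1.trans (le_of_eq ?_)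
  rw [← leftTranslate_sub, ← dagger_sub, lintegral_enorm_leftTranslate,
    lintegral_enorm_dagger μ (hfw.sub hf), lintegral_enorm_leftTranslate_inv_sub]

end Involution

/-! ### Convolution with an arbitrary element of `P₁(G)` -/

section Average

variable {G : Type*} [Group G] [TopologicalSpace G] [IsTopologicalGroup G]

theorem isCompactKernel_left {φ : G → ℝ} (hφ : Continuous φ) (hc : HasCompactSupport φ) :
    IsCompactKernel fun y x => φ (y⁻¹ * x) - φ x := by
  refine ⟨by fun_prop, fun C hC =>
    ⟨C * tsupport φ ∪ tsupport φ, (hC.mul hc.isCompact).union hc.isCompact, fun y hy x hx => ?_⟩⟩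
  rw [mem_union, not_or] at hx
  rw [image_eq_zero_of_notMem_tsupport hx.2, image_eq_zero_of_notMem_tsupport fun h =>
    hx.1 ⟨y, hy, _, h, mul_inv_cancel_left _ _⟩, sub_zero]

theorem isCompactKernel_right [LocallyCompactSpace G] [MeasurableSpace G] [BorelSpace G]
    {φ : G → ℝ} (hφ : Continuous φ) (hc : HasCompactSupport φ) :
    IsCompactKernel fun w x => (Measure.modularCharacter w : ℝ) * φ (x * w⁻¹) - φ x := by
  have hm : Continuous fun w : G => (Measure.modularCharacter w : ℝ) :=
    NNReal.continuous_coe.comp continuous_modularCharacter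
  refine ⟨?_, fun C hC =>
    ⟨tsupport φ * C ∪ tsupport φ, (hc.isCompact.mul hC).union hc.isCompact, fun w hw x hx => ?_⟩⟩
  · exact ((hm.comp continuous_fst).mul
      (hφ.comp (continuous_snd.mul continuous_fst.inv))).sub (hφ.comp continuous_snd)
  · rw [mem_union, not_or] at hx
    rw [image_eq_zero_of_notMem_tsupport hx.2, image_eq_zero_of_notMem_tsupport fun h =>
      hx.1 ⟨_, h, w, hw, inv_mul_cancel_right _ _⟩, mul_zero, sub_zero]

variable [MeasurableSpace G] [BorelSpace G] {μ : Measure G}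

theorem conv_sub_eq_integral_left {g φ : G → ℝ} (hg : IsP1 μ g) (hφ : Continuous φ)
    (hc : HasCompactSupport φ) (x : G) :
    conv μ g φ x - φ x = ∫ y, g y * (φ (y⁻¹ * x) - φ x) ∂μ := by
  obtain ⟨M, hM⟩ := hc.exists_bound_of_continuous hφ
  simp only [mul_sub]
  rw [integral_sub (integrable_mul_comp_inv_mul hg.integrable hφ.measurable hM x)
    (hg.integrable.mul_const _), integral_mul_const, hg.integral_eq_one, one_mul, conv]

/-- Substituting `y = x w⁻¹` in `∫ φ(y) g(y⁻¹ x) dy`. For fixed `x` the integrand vanishes off a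
compact set, so inversion is harmless although `g` is an arbitrary `L₁` function. -/
theorem conv_sub_eq_integral_right [LocallyCompactSpace G] [T2Space G] [μ.IsHaarMeasure]
    [μ.Regular] {g φ : G → ℝ} (hg : IsP1 μ g) (hφ : Continuous φ)
    (hc : HasCompactSupport φ) (x : G) :
    conv μ φ g x - φ x =
      ∫ w, g w * ((Measure.modularCharacter w : ℝ) * φ (x * w⁻¹) - φ x) ∂μ := by
  have hm : Continuous fun w : G => (Measure.modularCharacter w : ℝ) :=
    NNReal.continuous_coe.comp continuous_modularCharacter
  have hk : Continuous fun w => (Measure.modularCharacter w : ℝ) * φ (x * w⁻¹) := by fun_prop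
  have hks : HasCompactSupport fun w => (Measure.modularCharacter w : ℝ) * φ (x * w⁻¹) :=
    HasCompactSupport.mul_left
      (hc.comp_homeomorph ((Homeomorph.inv G).trans (Homeomorph.mulLeft x)))
  obtain ⟨M, hM⟩ := hks.exists_bound_of_continuous hk
  have hi : Integrable (fun w => g w * ((Measure.modularCharacter w : ℝ) * φ (x * w⁻¹))) μ :=
    hg.integrable.mul_bdd (c := M) hk.aestronglyMeasurable (Eventually.of_forall hM)
  simp only [mul_sub]
  rw [integral_sub hi (hg.integrable.mul_const _), integral_mul_const, hg.integral_eq_one, one_mul,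
    conv_eq_integral_mul_inv, ← integral_inv_mul_modularCharacter μ
      (C := x⁻¹ • tsupport φ) (hc.isCompact.smul x⁻¹)]
  · congr 1
    refine integral_congr_ae (Eventually.of_forall fun w => ?_)
    simp only [inv_inv]
    ring
  · intro w hw
    have hxw : φ (x * w) = 0 := image_eq_zero_of_notMem_tsupport fun h =>
      hw (mem_smul_set_iff_inv_smul_mem.2 (by simpa using h))
    rw [hxw, zero_mul]

end Average

/-! ### Support projections -/

section Support

variable {G : Type*} [MeasurableSpace G] {μ : Measure G}

/-- Up to null sets, the support projection of a pointwise nonnegative measurable `φ ∈ P₁(G)` is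
the set where `φ` does not vanish. -/
theorem IsP1.isSupportProjection_support {φ : G → ℝ} (hφ : IsP1 μ φ) (h0 : ∀ x, 0 ≤ φ x)
    (hm : Measurable φ) : IsSupportProjection μ φ (Function.support φ) := by
  refine ⟨measurableSet_support hm, fun P hP hPφ => ?_, fun Q _ hQP =>
    hQP _ (measurableSet_support hm) ?_⟩
  · have hc : ∫ x in Pᶜ, φ x ∂μ = 0 := by
      have := integral_add_compl hP hφ.integrable
      rw [hPφ, hφ.integral_eq_one] at this
      linarith
    rw [setIntegral_eq_zero_iff_of_nonneg_ae (Eventually.of_forall h0)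
      hφ.integrable.integrableOn, EventuallyEq, ae_restrict_iff' hP.compl] at hc
    filter_upwards [hc] with x hx hxs
    exact by_contra fun hxP => hxs (hx hxP)
  · rw [setIntegral_eq_integral_of_forall_compl_eq_zero fun x hx => Function.notMem_support.1 hx,
      hφ.integral_eq_one]

end Support

/-! ### The Følner convolutions -/

section Folner

variable {G : Type*} [MeasurableSpace G]

theorem normIndicator_nonneg (μ : Measure G) (F : Set G) (x : G) :
    0 ≤ normIndicator μ F x :=
  indicator_nonneg (fun _ _ => inv_nonneg.2 measureReal_nonneg) _

variable [Group G] [TopologicalSpace G] [IsTopologicalGroup G] [LocallyCompactSpace G] [T2Space G]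
  [BorelSpace G] {μ : Measure G} [μ.IsHaarMeasure] {F : Set G}

omit [IsTopologicalGroup G] [LocallyCompactSpace G] in
theorem integral_normIndicator (hF : IsCompact F) (h0 : 0 < μ F) :
    ∫ x, normIndicator μ F x ∂μ = 1 := by
  have hne : μ.real F ≠ 0 := (ENNReal.toReal_pos h0.ne' hF.measure_lt_top.ne).ne'
  rw [normIndicator, integral_indicator_const _ hF.measurableSet, smul_eq_mul, mul_inv_cancel₀ hne]

omit [IsTopologicalGroup G] [LocallyCompactSpace G] in
theorem lintegral_enorm_normIndicator (hF : IsCompact F) (h0 : 0 < μ F) :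
    ∫⁻ x, ‖normIndicator μ F x‖ₑ ∂μ = 1 := by
  rw [← ofReal_integral_norm_eq_lintegral_enorm ((isBddCompact_normIndicator μ hF).integrable μ)]
  simp only [Real.norm_eq_abs, abs_of_nonneg (normIndicator_nonneg μ F _),
    integral_normIndicator hF h0, ENNReal.ofReal_one]

omit [LocallyCompactSpace G] in
theorem lintegral_enorm_leftTranslate_normIndicator_sub_le (hF : IsCompact F) (h0 : 0 < μ F)
    (y : G) : ∫⁻ x, ‖(leftTranslate y (normIndicator μ F) - normIndicator μ F) x‖ₑ ∂μ ≤ 2 := by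
  have hb := isBddCompact_normIndicator μ hF
  calc _ ≤ ∫⁻ x, ‖leftTranslate y (normIndicator μ F) x‖ₑ + ‖normIndicator μ F x‖ₑ ∂μ :=
        lintegral_mono fun x => enorm_sub_le
    _ = 2 := by
        rw [lintegral_add_right _ hb.measurable.enorm, lintegral_enorm_leftTranslate,
          lintegral_enorm_normIndicator hF h0, one_add_one_eq_two]

theorem isBddCompact_translate_dagger (μ : Measure G) (hF : IsCompact F) (t : G) :
    IsBddCompact (leftTranslate t (dagger (normIndicator μ F))) :=
  (isBddCompact_normIndicator μ hF).dagger.leftTranslate t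

omit [T2Space G] [BorelSpace G] in
theorem support_folnerConv_subset (μ : Measure G) (F : Set G) (t : G) :
    Function.support (folnerConv μ F t) ⊆ F * {t} * F⁻¹ := by
  intro x hx
  rw [mul_assoc]
  refine mem_mul_of_conv_ne_zero (fun y hy => indicator_of_notMem hy _) (fun z hz => ?_) hx
  rw [leftTranslate, dagger_apply, normIndicator, indicator_of_notMem, mul_zero]
  exact fun h => hz ⟨t, rfl, t⁻¹ * z, h, mul_inv_cancel_left _ _⟩

theorem hasCompactSupport_folnerConv (μ : Measure G) (hF : IsCompact F) (t : G) :
    HasCompactSupport (folnerConv μ F t) :=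
  hasCompactSupport_conv μ (isBddCompact_normIndicator μ hF) (isBddCompact_translate_dagger μ hF t)

omit [T2Space G] [BorelSpace G] in
theorem folnerConv_nonneg (μ : Measure G) (F : Set G) (t x : G) : 0 ≤ folnerConv μ F t x :=
  conv_nonneg (normIndicator_nonneg μ F) (fun _ => dagger_nonneg (normIndicator_nonneg μ F) _) x

variable [μ.Regular]

theorem continuous_folnerConv (hF : IsCompact F) (t : G) : Continuous (folnerConv μ F t) :=
  continuous_conv μ (isBddCompact_normIndicator μ hF) (isBddCompact_translate_dagger μ hF t)
    fun _ => dagger_nonneg (normIndicator_nonneg μ F) _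

theorem isP1_folnerConv (hF : IsCompact F) (h0 : 0 < μ F) (t : G) :
    IsP1 μ (folnerConv μ F t) := by
  refine ⟨(continuous_folnerConv hF t).integrable_of_hasCompactSupport
    (hasCompactSupport_folnerConv μ hF t), Eventually.of_forall (folnerConv_nonneg μ F t), ?_⟩
  have ht : ∫ x, leftTranslate t (dagger (normIndicator μ F)) x ∂μ = 1 := by
    simp only [leftTranslate]
    rw [integral_mul_left_eq_self (dagger (normIndicator μ F)) t⁻¹,
      integral_dagger μ (isBddCompact_normIndicator μ hF), integral_normIndicator hF h0]
  rw [folnerConv, integral_conv μ (isBddCompact_normIndicator μ hF)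
    (isBddCompact_translate_dagger μ hF t) fun _ => dagger_nonneg (normIndicator_nonneg μ F) _,
    ht, integral_normIndicator hF h0, one_mul]

theorem lintegral_enorm_folnerConv_left_le (hF : IsCompact F) (h0 : 0 < μ F) (t y : G) :
    ∫⁻ x, ‖folnerConv μ F t (y⁻¹ * x) - folnerConv μ F t x‖ₑ ∂μ ≤
      ∫⁻ x, ‖(leftTranslate y (normIndicator μ F) - normIndicator μ F) x‖ₑ ∂μ := by
  have hb := isBddCompact_normIndicator μ hF
  refine (lintegral_enorm_conv_left_sub_le μ hb (isBddCompact_translate_dagger μ hF t) y).trans_eq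
    ?_
  rw [lintegral_enorm_leftTranslate, lintegral_enorm_dagger μ hb,
    lintegral_enorm_normIndicator hF h0, mul_one]

theorem lintegral_enorm_folnerConv_right_le (hF : IsCompact F) (h0 : 0 < μ F) (t w : G) :
    ∫⁻ x, ‖(Measure.modularCharacter w : ℝ) * folnerConv μ F t (x * w⁻¹) -
        folnerConv μ F t x‖ₑ ∂μ ≤
      ∫⁻ x, ‖(leftTranslate w (normIndicator μ F) - normIndicator μ F) x‖ₑ ∂μ := by
  have hb := isBddCompact_normIndicator μ hF
  refine (lintegral_enorm_conv_right_sub_le μ hb hb t w).trans_eq ?_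
  rw [lintegral_enorm_normIndicator hF h0, one_mul]

theorem IsFolnerNet.isTwoSidedTINet {𝒦 : Set (Set G)} (h𝒦 : IsKappaFamily 𝒦)
    {F : Idx 𝒦 → Set G} (hF : IsFolnerNet μ F) (t : Idx 𝒦 → G) :
    IsTwoSidedTINet μ fun γ => folnerConv μ (F γ) (t γ) := by
  have hbdd := fun γ y =>
    lintegral_enorm_leftTranslate_normIndicator_sub_le (hF.isCompact γ) (hF.measure_pos γ) y
  have hinv : ∀ γ, ∀ y ∈ (γ.1 : Set G),
      ∫⁻ x, ‖(leftTranslate y (normIndicator μ (F γ)) - normIndicator μ (F γ)) x‖ₑ ∂μ ≤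
        ((γ.2 : ℕ) : ℝ≥0∞)⁻¹ := fun γ y hy => by
    rw [← eLpNorm_one_eq_lintegral_enorm]
    exact (hF.invariant γ y hy).le
  have hcont := fun γ => continuous_folnerConv (μ := μ) (hF.isCompact γ) (t γ)
  have hcs := fun γ => hasCompactSupport_folnerConv μ (hF.isCompact γ) (t γ)
  have hl := fun γ => lintegral_enorm_folnerConv_left_le (hF.isCompact γ) (hF.measure_pos γ) (t γ)
  have hr := fun γ => lintegral_enorm_folnerConv_right_le (hF.isCompact γ) (hF.measure_pos γ) (t γ)
  refine ⟨⟨(Classical.choice h𝒦.nonempty, 1)⟩, h𝒦.directed_idx,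
    fun γ => isP1_folnerConv (hF.isCompact γ) (hF.measure_pos γ) (t γ), fun g hg => ?_,
    fun g hg => ?_⟩
  · simp only [eLpNorm_one_eq_lintegral_enorm, Pi.sub_apply,
      conv_sub_eq_integral_left hg (hcont _) (hcs _)]
    exact tendsto_lintegral_enorm_integral_kernel h𝒦
      (fun γ => isCompactKernel_left (hcont γ) (hcs γ)) (fun γ y => (hl γ y).trans (hbdd γ y))
      (fun γ y hy => (hl γ y).trans (hinv γ y hy)) hg.integrable
  · simp only [eLpNorm_one_eq_lintegral_enorm, Pi.sub_apply,
      conv_sub_eq_integral_right hg (hcont _) (hcs _)]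
    exact tendsto_lintegral_enorm_integral_kernel h𝒦
      (fun γ => isCompactKernel_right (hcont γ) (hcs γ)) (fun γ y => (hr γ y).trans (hbdd γ y))
      (fun γ y hy => (hr γ y).trans (hinv γ y hy)) hg.integrable

theorem orthogonal_folnerConv {E F : Set G} (hE : IsCompact E) (hE0 : 0 < μ E)
    (hF : IsCompact F) (hF0 : 0 < μ F) {s t : G}
    (hd : Disjoint (E * {s} * E⁻¹) (F * {t} * F⁻¹)) :
    Orthogonal μ (folnerConv μ E s) (folnerConv μ F t) := by
  refine ⟨_, _, (isP1_folnerConv hE hE0 s).isSupportProjection_support (folnerConv_nonneg μ E s)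
    (continuous_folnerConv hE s).measurable, (isP1_folnerConv hF hF0 t).isSupportProjection_support
    (folnerConv_nonneg μ F t) (continuous_folnerConv hF t).measurable, ?_⟩
  rw [(hd.mono (support_folnerConv_subset μ E s) (support_folnerConv_subset μ F t)).inter_eq,
    measure_empty]

end Folner

end DisjointFolner

theorem mainTheorem6 {G : Type*} [Group G] [TopologicalSpace G] [IsTopologicalGroup G]
    [LocallyCompactSpace G] [T2Space G] [NoncompactSpace G] [MeasurableSpace G] [BorelSpace G]
    (μ : Measure G) [μ.IsHaarMeasure] [μ.Regular]
    (𝒦 : Set (Set G)) (h𝒦 : DisjointFolner.IsKappaFamily 𝒦)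
    (F : DisjointFolner.Idx 𝒦 → Set G) (hF : DisjointFolner.IsFolnerNet μ F) :
    (∃ t : DisjointFolner.Idx 𝒦 → G,
      Pairwise fun γ β => Disjoint (F γ * {t γ} * (F γ)⁻¹) (F β * {t β} * (F β)⁻¹)) ∧
    (∀ (γ : DisjointFolner.Idx 𝒦) (t : G),
      Function.support (DisjointFolner.folnerConv μ (F γ) t) ⊆ F γ * {t} * (F γ)⁻¹) ∧
    (∀ t : DisjointFolner.Idx 𝒦 → G,
      (Pairwise fun γ β => Disjoint (F γ * {t γ} * (F γ)⁻¹) (F β * {t β} * (F β)⁻¹)) →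
      DisjointFolner.IsTwoSidedTINet μ (fun γ => DisjointFolner.folnerConv μ (F γ) (t γ)) ∧
      Pairwise fun γ β => DisjointFolner.Orthogonal μ
        (DisjointFolner.folnerConv μ (F γ) (t γ)) (DisjointFolner.folnerConv μ (F β) (t β))) := by
  refine ⟨DisjointFolner.exists_pairwise_disjoint_translates h𝒦.mk_idx hF.isCompact,
    fun γ t => DisjointFolner.support_folnerConv_subset μ (F γ) t, fun t ht =>
    ⟨hF.isTwoSidedTINet h𝒦 t, fun γ β hγβ => ?_⟩⟩
  exact DisjointFolner.orthogonal_folnerConv (hF.isCompact γ) (hF.measure_pos γ) (hF.isCompact β)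
    (hF.measure_pos β) (ht hγβ)
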